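/- Let $G=(V,E)$ be an infinite, connected, simple graph with finite vertex-degrees. Let $\Gamma$ be a subgroup of $\mathrm{Aut}(G)$ that acts transitively on $V$, and let $\mathcal A$ be a non-trivial normal subgroup of $\Gamma$ (that is, $\mathcal A\neq\{\mathrm{id}\}$). For $v\in V$ write $\partial v$ for the set of neighbours of $v$ and $\overline v=\mathcal A v$ for its orbit under $\mathcal A$. The directed quotient graph $\vec G=G/\mathcal A$ is the directed multigraph whose vertices are the $\mathcal A$-orbits, with $|\partial v\cap\overline w|$ directed edges from $\overline v$ to $\overline w$ (directed loops if $\overline v=\overline w$), for $v,w\in V$. A self-avoiding walk (SAW) is a walk that visits no vertex more than once; on $\vec G$ walks follow directed edges, and walks that use different parallel edges are counted as different. The connective constant $\mu(H)$ of $H=G$ or $H=\vec G$ is the limit $\lim_{n\to\infty}\sigma_n(x)^{1/n}$, where $\sigma_n(x)$ is the number of $n$-step SAWs on $H$ starting at the vertex $x$, if this limit exists for every vertex $x$ and does not depend on $x$ (so that $\mu(\vec G)=0$ if $\vec G$ is finite). Let $L=L(G,\mathcal A)$ be the length of the shortest SAW of $G$ whose endpoints are distinct and lie in the same $\mathcal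 A$-orbit. Then the connective constants $\mu(G)$ and $\mu(\vec G)$ exist, and $\mu(\vec G)<\mu(G)$, provided that either (a) $L\ne 2$, or (b) $L=2$ and at least one of the following holds: (i) $G$ contains a $2$-step SAW $v=w_0,w_1,w_2=v'$ with $\overline v=\overline{v'}$ and $|\partial v\cap\overline{w_1}|\ge 2$; (ii) $G$ contains a SAW $v=w_0,w_1,\dots,w_l=v'$ with $\overline v=\overline{v'}$ and $\overline{w_i}\ne\overline{w_j}$ for $0\le i<j<l$, and such that $v'=\alpha v$ for some $\alpha\in\mathcal A$ that fixes no $w_i$. -/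

import Mathlib

noncomputable section

namespace SAW

/-! ### Self-avoiding walks on a simple graph -/

/-- The number `σ_n(v)` of `n`-step self-avoiding walks of `G` that start at `v`
(`SimpleGraph.Walk.IsPath` says that no vertex is visited twice). -/
def sawCount {V : Type*} (G : SimpleGraph V) (v : V) (n : ℕ) : ℕ :=
  Nat.card {p : Σ w : V, G.Walk v w // p.2.IsPath ∧ p.2.length = n}

/-- `m` is the connective constant of the graph `G`: for every starting vertex `v`,
`σ_n(v)^{1/n} → m` as `n → ∞`. -/
def IsConnectiveConstant {V : Type*} (G : SimpleGraph V) (m : ℝ) : Prop :=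
  ∀ v : V, Filter.Tendsto (fun n : ℕ => (sawCount G v n : ℝ) ^ ((1 : ℝ) / (n : ℝ)))
    Filter.atTop (nhds m)

/-! ### Self-avoiding walks on a directed multigraph -/

/-- The number of `n`-step directed self-avoiding walks from `x` on a directed multigraph, given as
a quiver. A `Quiver.Path` records the edges used, so that walks through the same vertices by
different parallel edges are counted separately; its list of `n + 1` visited vertices has to be free
of repetitions. -/
def dirSawCount (Q : Type*) [Quiver Q] (x : Q) (n : ℕ) : ℕ :=
  Nat.card {p : Σ y : Q, Quiver.Path x y // p.2.vertices.Nodup ∧ p.2.length = n}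

/-- `m` is the connective constant of the directed multigraph `Q`: for every starting vertex `x`,
the `n`-th root of the number of `n`-step directed self-avoiding walks from `x` tends to `m`. -/
def IsDirConnectiveConstant (Q : Type*) [Quiver Q] (m : ℝ) : Prop :=
  ∀ x : Q, Filter.Tendsto (fun n : ℕ => (dirSawCount Q x n : ℝ) ^ ((1 : ℝ) / (n : ℝ)))
    Filter.atTop (nhds m)

/-! ### The directed quotient graph -/

variable {V : Type*} {G : SimpleGraph V}

/-- The number `|∂v ∩ S|` of neighbours of `v` that lie in `S`. -/
def nbrCount (G : SimpleGraph V) (v : V) (S : Set V) : ℕ := (G.neighborSet v ∩ S).ncard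

/-- If `S` is a union of `A`-orbits, then `|∂v ∩ S|` depends only on the orbit of `v`. -/
theorem nbrCount_smul (g : G ≃g G) (v : V) (S : Set V) (hS : ∀ w, g • w ∈ S ↔ w ∈ S) :
    nbrCount G (g • v) S = nbrCount G v S := by
  unfold nbrCount
  have h : G.neighborSet (g • v) ∩ S = (fun w : V => g • w) '' (G.neighborSet v ∩ S) := by
    ext w
    constructor
    · rintro ⟨h1, h2⟩
      have hw : g • (g⁻¹ • w) = w := smul_inv_smul g w
      refine ⟨g⁻¹ • w, ⟨?_, ?_⟩, hw⟩
      · rw [SimpleGraph.mem_neighborSet] at h1 ⊢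
        rw [← hw] at h1
        exact g.map_adj_iff.1 h1
      · rw [← hS, hw]
        exact h2
    · rintro ⟨u, ⟨h1, h2⟩, rfl⟩
      exact ⟨g.map_adj_iff.2 h1, (hS u).2 h2⟩
  rw [h]
  exact Set.ncard_image_of_injective _ (MulAction.injective g)

/-- The number of directed edges from the orbit `x` to the orbit `y`: it is `|∂v ∩ y|` for any
representative `v` of `x`. -/
def edgeMult (A : Subgroup (G ≃g G)) (x y : MulAction.orbitRel.Quotient A V) : ℕ :=
  Quotient.lift (fun v : V => nbrCount G v (MulAction.orbitRel.Quotient.orbit y))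
    (by
      rintro _ v ⟨a, rfl⟩
      refine nbrCount_smul (a : G ≃g G) v _ fun w => ?_
      rw [MulAction.orbitRel.Quotient.mem_orbit, MulAction.orbitRel.Quotient.mem_orbit]
      have : (Quotient.mk'' ((a : G ≃g G) • w) : MulAction.orbitRel.Quotient A V)
          = Quotient.mk'' w := Quotient.sound' ⟨a, rfl⟩
      rw [this]) x

/-- The vertex set of the directed quotient graph `G/A`: the orbits of `A` on `V`. -/
def DirQuotient (A : Subgroup (G ≃g G)) : Type _ := MulAction.orbitRel.Quotient A V

/-- The directed quotient graph `G/A`, with `|∂v ∩ Aw|` directed edges from `Av` to `Aw` (directed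
loops if `Av = Aw`). -/
instance (A : Subgroup (G ≃g G)) : Quiver (DirQuotient A) where
  Hom x y := Fin (edgeMult A x y)

/-- For all vertices `v`, `w`, there are `|∂v ∩ Aw|` directed edges from `Av` to `Aw`. -/
theorem edgeMult_mk (A : Subgroup (G ≃g G)) (v w : V) :
    edgeMult A (Quotient.mk'' v) (Quotient.mk'' w) = nbrCount G v (MulAction.orbit A w) := rfl

/-! ### The length `L` and the two conditions for `L = 2` -/

/-- The length `L(G, A)` of the shortest self-avoiding walk of `G` whose endpoints are distinct and
lie in the same `A`-orbit. -/
def orbitLength (A : Subgroup (G ≃g G)) : ℕ :=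
  sInf {n : ℕ | ∃ (v w : V) (p : G.Walk v w),
    p.IsPath ∧ v ≠ w ∧ w ∈ MulAction.orbit A v ∧ p.length = n}

/-- There is a `2`-step self-avoiding walk `v = w₀, w₁, w₂ = v'` with `Av = Av'` and
`|∂v ∩ Aw₁| ≥ 2`. -/
def CondI (A : Subgroup (G ≃g G)) : Prop :=
  ∃ (v v' : V) (p : G.Walk v v'), p.IsPath ∧ p.length = 2 ∧ v' ∈ MulAction.orbit A v ∧
    2 ≤ nbrCount G v (MulAction.orbit A (p.getVert 1))

/-- There is a self-avoiding walk `v = w₀, w₁, …, w_l = v'` with `Av = Av'`, with `Aw_i ≠ Aw_j` for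
`0 ≤ i < j < l`, and with `v' = αv` for some `α ∈ A` that fixes no `w_i`. -/
def CondII (A : Subgroup (G ≃g G)) : Prop :=
  ∃ (v v' : V) (p : G.Walk v v'), p.IsPath ∧ v' ∈ MulAction.orbit A v ∧
    (∀ i j : ℕ, i < j → j < p.length →
      MulAction.orbit A (p.getVert i) ≠ MulAction.orbit A (p.getVert j)) ∧
    ∃ α ∈ A, v' = α v ∧ ∀ i ≤ p.length, α (p.getVert i) ≠ p.getVert i

end SAW

end

/-! Walks on the directed quotient lift uniquely to walks of `G` once a lift of the first vertex is
fixed, so self-avoiding walks on the quotient correspond to transversal walks of `G`, those that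
meet every `A`-orbit at most once (`dirSawCount_eq_cnt`). Both this count and the count of
self-avoiding walks are submultiplicative, so both constants exist by Fekete's lemma. It remains to
find one `n` for which there are fewer than `μ ^ n` transversal walks (`exists_transversal_lt`).

This is an argument in the style of Kesten's pattern theorem. Each of the allowed cases yields a
`Pattern`: a union `S` of finitely many orbits in which one can travel from any vertex to any orbit
by a self-avoiding walk that repeats an orbit. If a walk is transversal, the stretch between its
first and last visit to a translate of `S` can be replaced by such a detour, the remainder being
shifted by an element of `A`. The new walk is self-avoiding but no longer transversal. Performing
this at many independent places produces exponentially more self-avoiding walks than there were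
transversal ones.

To find these places, call a walk `K`-free if it visits each translate of `S` fewer than `K` times,
and show by induction on `K` that transversal `K`-free walks are exponentially rarer than `μ ^ n`.
For `K = 1` there are none of positive length, by transitivity; for `K` larger than the number of
orbits in `S`, every transversal walk is `K`-free. For the step (`exists_freeCount_succ_lt`), cut a
`(K + 1)`-free walk into blocks. If few blocks contain `K` visits to one translate, most blocks are
essentially `K`-free and the induction hypothesis bounds the number of walks. If many do, each such
translate is visited in that block only, a positive proportion of these translates is pairwise
disjoint (`exists_disjoint_bad`), and any subset of the corresponding blocks can be rewritten. The
rewriting can be decoded at bounded cost per replaced block (`sum_rewrite_le_one`), so comparison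
with the generating function of self-avoiding walks just inside its radius of convergence gives the
bound (`sum_weight_bad_le`). -/

namespace SAW

/-! ### Walks as vertex lists, and their counts -/

section Walks

open scoped Classical

variable {V : Type*} (G : SimpleGraph V)

/-- `l` lists the vertices after `v` of a walk of `G` that starts at `v`. -/
def IsWalkFrom : V → List V → Prop
  | _, [] => True
  | v, a :: l => G.Adj v a ∧ IsWalkFrom a l

/-- The last vertex of the walk that starts at `v` and then visits the vertices in `l`. -/
def endpt {V : Type*} : V → List V → V
  | v, [] => v
  | _, a :: l => endpt a l

@[simp] theorem isWalkFrom_nil (v : V) : IsWalkFrom G v [] := trivial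

@[simp] theorem isWalkFrom_cons (v a : V) (l : List V) :
    IsWalkFrom G v (a :: l) ↔ G.Adj v a ∧ IsWalkFrom G a l := Iff.rfl

@[simp] theorem endpt_nil (v : V) : endpt v [] = v := rfl

@[simp] theorem endpt_cons (v a : V) (l : List V) : endpt v (a :: l) = endpt a l := rfl

@[simp] theorem endpt_append (v : V) (l l' : List V) :
    endpt v (l ++ l') = endpt (endpt v l) l' := by
  induction l generalizing v with
  | nil => rfl
  | cons a l ih => simp [ih]

@[simp] theorem isWalkFrom_append (v : V) (l l' : List V) :
    IsWalkFrom G v (l ++ l') ↔ IsWalkFrom G v l ∧ IsWalkFrom G (endpt v l) l' := by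
  induction l generalizing v with
  | nil => simp
  | cons a l ih => simp [ih, and_assoc]

variable {G}

@[simp] theorem endpt_map (g : G ≃g G) (v : V) (l : List V) :
    endpt (g v) (l.map g) = g (endpt v l) := by
  induction l generalizing v with
  | nil => rfl
  | cons a l ih => simp [ih]

@[simp] theorem isWalkFrom_map (g : G ≃g G) (v : V) (l : List V) :
    IsWalkFrom G (g v) (l.map g) ↔ IsWalkFrom G v l := by
  induction l generalizing v with
  | nil => simp
  | cons a l ih => simp [ih, g.map_adj_iff]

theorem endpt_mem (v : V) (l : List V) : endpt v l ∈ v :: l := by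
  induction l generalizing v with
  | nil => simp
  | cons a l ih => rw [endpt_cons]; exact List.mem_cons_of_mem _ (ih a)

variable (G) [G.LocallyFinite]

/-- The walks with `n` steps from `v`, each given by the list of its vertices after `v`. -/
noncomputable def walks : V → ℕ → Finset (List V)
  | _, 0 => {[]}
  | v, n + 1 => (G.neighborFinset v).biUnion fun a => (walks a n).image (List.cons a)

theorem mem_walks {v : V} {n : ℕ} {l : List V} :
    l ∈ walks G v n ↔ IsWalkFrom G v l ∧ l.length = n := by
  induction n generalizing v l with
  | zero =>
    simp only [walks, Finset.mem_singleton, List.length_eq_zero_iff]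
    constructor
    · rintro rfl; simp
    · exact fun h => h.2
  | succ n ih =>
    simp only [walks, Finset.mem_biUnion, SimpleGraph.mem_neighborFinset, Finset.mem_image, ih]
    constructor
    · rintro ⟨a, ha, l', ⟨h1, h2⟩, rfl⟩
      simp [ha, h1, h2]
    · rintro ⟨h1, h2⟩
      cases l with
      | nil => simp at h2
      | cons a l => exact ⟨a, h1.1, l, ⟨h1.2, by simpa using h2⟩, rfl⟩

/-- Summing over walks with `m + n` steps by splitting them after `m` steps. -/
theorem sum_walks_add {M : Type*} [AddCommMonoid M] (v : V) (m n : ℕ) (f : List V → M) :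
    ∑ l ∈ walks G v (m + n), f l
      = ∑ l₁ ∈ walks G v m, ∑ l₂ ∈ walks G (endpt v l₁) n, f (l₁ ++ l₂) := by
  rw [Finset.sum_sigma']
  refine Finset.sum_bij' (fun l _ => ⟨l.take m, l.drop m⟩) (fun x _ => x.1 ++ x.2) ?_ ?_ ?_ ?_ ?_
  · intro l hl
    rw [mem_walks] at hl
    have h := hl.1
    rw [← List.take_append_drop m l, isWalkFrom_append] at h
    simp only [Finset.mem_sigma, mem_walks, List.length_take, List.length_drop, hl.2]
    exact ⟨⟨h.1, by omega⟩, h.2, by omega⟩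
  · rintro ⟨l₁, l₂⟩ h
    simp only [Finset.mem_sigma, mem_walks] at h ⊢
    simp [h.1.1, h.1.2, h.2.1, h.2.2]
  · intro l _
    simp
  · rintro ⟨l₁, l₂⟩ h
    simp only [Finset.mem_sigma, mem_walks] at h
    simp [← h.1.2]
  · intro l _
    simp

theorem sum_walks_map {M : Type*} [AddCommMonoid M] (g : G ≃g G) (v : V) (n : ℕ)
    (f : List V → M) :
    ∑ l ∈ walks G (g v) n, f l = ∑ l ∈ walks G v n, f (l.map g) := by
  symm
  refine Finset.sum_bij' (fun l _ => l.map g) (fun l _ => l.map g.symm) ?_ ?_ ?_ ?_ ?_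
  · intro l hl
    rw [mem_walks] at hl ⊢
    simpa using hl
  · intro l hl
    rw [mem_walks] at hl ⊢
    refine ⟨?_, by simpa using hl.2⟩
    rw [← isWalkFrom_map g]
    simpa [Function.comp_def] using hl.1
  · intro l _
    simp [Function.comp_def]
  · intro l _
    simp [Function.comp_def]
  · intro l _
    rfl

/-- The number of `n`-step walks from `v` with the property `P v`. -/
noncomputable def cnt (P : V → List V → Prop) (v : V) (n : ℕ) : ℕ := ((walks G v n).filter (P v)).card

theorem cnt_eq_sum (P : V → List V → Prop) (v : V) (n : ℕ) :
    (cnt G P v n : ℝ) = ∑ l ∈ walks G v n, if P v l then 1 else 0 := by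
  simp [cnt, Finset.sum_boole]

theorem cnt_eq_zero_iff {P : V → List V → Prop} {v : V} {n : ℕ} :
    cnt G P v n = 0 ↔ ∀ l ∈ walks G v n, ¬ P v l := by
  rw [cnt, Finset.card_eq_zero, Finset.filter_eq_empty_iff]

theorem cnt_map (P : V → List V → Prop) (g : G ≃g G) (hP : ∀ v l, P (g v) (l.map g) ↔ P v l)
    (v : V) (n : ℕ) : cnt G P (g v) n = cnt G P v n := by
  have := sum_walks_map G g v n (fun l => if P (g v) l then (1 : ℝ) else 0)
  rw [← cnt_eq_sum] at this
  simp only [hP] at this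
  rw [← cnt_eq_sum] at this
  exact_mod_cast this

theorem cnt_mono {P Q : V → List V → Prop} (v : V) (n : ℕ)
    (h : ∀ l ∈ walks G v n, P v l → Q v l) : cnt G P v n ≤ cnt G Q v n := by
  refine Finset.card_le_card fun l hl => ?_
  rw [Finset.mem_filter] at hl ⊢
  exact ⟨hl.1, h l hl.1 hl.2⟩

/-- Allowing three different properties lets one splitting argument serve both for
submultiplicativity and for the mixed estimates, where the two halves are constrained differently.
-/
theorem cnt_add_le {P Q R : V → List V → Prop} {m n C : ℕ} {v : V}
    (hP : ∀ l l', l.length = m → l'.length = n → P v (l ++ l') → Q v l ∧ R (endpt v l) l')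
    (hR : ∀ w, cnt G R w n ≤ C) :
    cnt G P v (m + n) ≤ cnt G Q v m * C := by
  have key : (cnt G P v (m + n) : ℝ) ≤ cnt G Q v m * C := by
    rw [cnt_eq_sum, sum_walks_add, cnt_eq_sum, Finset.sum_mul]
    refine Finset.sum_le_sum fun l hl => ?_
    by_cases hq : Q v l
    · rw [if_pos hq, one_mul]
      refine le_trans ?_ (Nat.cast_le.2 (hR (endpt v l)))
      rw [cnt_eq_sum]
      refine Finset.sum_le_sum fun l' hl' => ?_
      by_cases h : P v (l ++ l')
      · rw [if_pos h, if_pos (hP l l' ((mem_walks G).1 hl).2 ((mem_walks G).1 hl').2 h).2]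
      · rw [if_neg h]
        split_ifs <;> norm_num
    · rw [if_neg hq, zero_mul]
      refine (Finset.sum_eq_zero fun l' hl' => ?_).le
      exact if_neg fun h => hq (hP l l' ((mem_walks G).1 hl).2 ((mem_walks G).1 hl').2 h).1
  exact_mod_cast key

end Walks

/-! ### Replacing parts of a transversal walk by detours -/

section Surgery

open scoped Classical

variable {V : Type*} {G : SimpleGraph V}

/-- The `A`-orbit of a vertex, as a vertex of the quotient. -/
def orb (A : Subgroup (G ≃g G)) (v : V) : MulAction.orbitRel.Quotient A V := Quotient.mk'' v

theorem orb_eq_iff {A : Subgroup (G ≃g G)} {v w : V} : orb A v = orb A w ↔ ∃ a ∈ A, a w = v := by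
  unfold orb
  rw [Quotient.eq'', MulAction.orbitRel_apply]
  constructor
  · rintro ⟨a, h⟩
    exact ⟨a, a.2, h⟩
  · rintro ⟨a, ha, h⟩
    exact ⟨⟨a, ha⟩, h⟩

@[simp] theorem orb_apply {A : Subgroup (G ≃g G)} {a : G ≃g G} (ha : a ∈ A) (v : V) :
    orb A (a v) = orb A v := orb_eq_iff.2 ⟨a, ha, rfl⟩

/-- The vertices of `l` lie in distinct orbits. -/
def Transversal (A : Subgroup (G ≃g G)) (l : List V) : Prop := (l.map (orb A)).Nodup

/-- `S` is a union of finitely many orbits, and from every vertex `x` of `S` the orbit of every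
vertex `y` of `S` can be reached by a self-avoiding walk in `S` that visits some orbit twice. -/
structure Pattern (A : Subgroup (G ≃g G)) (S : Set V) (r : ℕ) : Prop where
  inv : ∀ a ∈ A, ∀ w, a w ∈ S ↔ w ∈ S
  nonempty : S.Nonempty
  finite : (orb A '' S).Finite
  detour : ∀ x ∈ S, ∀ y ∈ S, ∃ d : List V, ∃ a ∈ A, IsWalkFrom G x d ∧ endpt x d = a y ∧
    (x :: d).Nodup ∧ (∀ w ∈ d, w ∈ S) ∧ ¬ Transversal A (x :: d) ∧ d.length < r

/-- The vertex list `R` arises from `B` by replacing the part between the first and the last visit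
to `Y` by a detour in `Y` that visits an orbit twice, and shifting what follows by `a ∈ A`. -/
structure IsSurgery (A : Subgroup (G ≃g G)) (Y : Set V) (m r : ℕ) (B R : List V) (a : G ≃g G) :
    Prop where
  mem : a ∈ A
  walk : ∀ v, IsWalkFrom G v B → IsWalkFrom G v R ∧ endpt v R = a (endpt v B)
  nodup : Transversal A B → R.Nodup
  sub : ∀ w ∈ R, w ∈ Y ∨ orb A w ∈ B.map (orb A)
  length : R.length ≤ B.length + r
  repeats : ∃ P, P <+: R ∧ P.length ≤ m + r ∧ ¬ Transversal A P

theorem exists_last_visit {Y : Set V} (x : V) (l : List V) (hx : x ∈ Y) :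
    ∃ C Q, l = C ++ Q ∧ endpt x C ∈ Y ∧ ∀ w ∈ Q, w ∉ Y := by
  induction l using List.reverseRecOn with
  | nil => exact ⟨[], [], rfl, hx, by simp⟩
  | append_singleton l a ih =>
    by_cases ha : a ∈ Y
    · exact ⟨l ++ [a], [], by simp, by simpa using ha, by simp⟩
    · obtain ⟨C, Q, rfl, h1, h2⟩ := ih
      refine ⟨C, Q ++ [a], by simp, h1, ?_⟩
      intro w hw
      rcases List.mem_append.1 hw with h | h
      · exact h2 w h
      · rw [List.mem_singleton.1 h]; exact ha

theorem exists_first_visit {Y : Set V} (m : ℕ) (B : List V) (h : ∃ w ∈ B.take m, w ∈ Y) :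
    ∃ P x l, B = P ++ x :: l ∧ x ∈ Y ∧ P.length < m ∧ ∀ w ∈ P, w ∉ Y := by
  induction B generalizing m with
  | nil => simp at h
  | cons b B ih =>
    cases m with
    | zero => simp at h
    | succ m =>
      by_cases hb : b ∈ Y
      · exact ⟨[], b, B, rfl, hb, by simp, by simp⟩
      · obtain ⟨w, hw, hY⟩ := h
        rw [List.take_succ_cons, List.mem_cons] at hw
        have hw' : w ∈ B.take m := by
          rcases hw with rfl | hw
          · exact absurd hY hb
          · exact hw
        obtain ⟨P, x, l, rfl, h1, h2, h3⟩ := ih m ⟨w, hw', hY⟩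
        refine ⟨b :: P, x, l, rfl, h1, by simpa using h2, ?_⟩
        intro w hw
        rcases List.mem_cons.1 hw with rfl | hw
        · exact hb
        · exact h3 w hw

/-- Write `B` as an initial part avoiding `Y`, a stretch from the first to the last visit, and a
final part avoiding `Y`. The detour ends in the orbit of the last visit, so a shift by `a ∈ A`
reattaches the final part. Since `Y` is `A`-invariant the shifted part still avoids the detour, and
since shifting preserves orbits it still avoids the initial part. The first visit occurs within `m`
entries and the detour has fewer than `r` steps, whence the position of the repeated orbit. -/
theorem Pattern.exists_surgery {A : Subgroup (G ≃g G)} {Y : Set V} {r : ℕ} (hY : Pattern A Y r)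
    (m : ℕ) (B : List V) (h : ∃ w ∈ B.take m, w ∈ Y) : ∃ R a, IsSurgery A Y m r B R a := by
  obtain ⟨P, x, l, rfl, hx, hPm, hP⟩ := exists_first_visit m B h
  obtain ⟨C, Q, rfl, hy, hQ⟩ := exists_last_visit x l hx
  obtain ⟨d, a, ha, hdw, hde, hdn, hdY, hdt, hdr⟩ := hY.detour x hx _ hy
  have hdY' : ∀ w ∈ x :: d, w ∈ Y := by
    intro w hw
    rcases List.mem_cons.1 hw with rfl | hw
    · exact hx
    · exact hdY w hw
  have haQ : ∀ w ∈ Q.map a, w ∉ Y ∧ orb A w ∈ Q.map (orb A) := by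
    intro w hw
    obtain ⟨q, hq, rfl⟩ := List.mem_map.1 hw
    rw [hY.inv a ha, orb_apply ha]
    exact ⟨hQ q hq, List.mem_map_of_mem hq⟩
  refine ⟨P ++ (x :: d) ++ Q.map a, a, ha, ?_, ?_, ?_, ?_, P ++ (x :: d), ⟨Q.map a, rfl⟩, ?_, ?_⟩
  · intro v hv
    simp only [isWalkFrom_append, isWalkFrom_cons, endpt_append, endpt_cons, hde] at hv ⊢
    refine ⟨⟨⟨hv.1, hv.2.1, hdw⟩, ?_⟩, ?_⟩
    · rw [isWalkFrom_map]; exact hv.2.2.2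
    · rw [endpt_map]
  · intro ht
    unfold Transversal at ht
    simp only [List.map_append, List.map_cons, ← List.cons_append] at ht
    rw [List.nodup_append] at ht
    obtain ⟨hPn, hCQ, hPCQ⟩ := ht
    rw [List.nodup_append] at hCQ
    rw [List.nodup_append, List.nodup_append]
    refine ⟨⟨List.Nodup.of_map _ hPn, hdn, ?_⟩, ?_, ?_⟩
    · rintro p hp w hw rfl
      exact hP p hp (hdY' p hw)
    · exact (List.Nodup.of_map _ hCQ.2.1).map a.injective
    · rintro p hp w hw rfl
      rcases List.mem_append.1 hp with hp | hp
      · exact hPCQ _ (List.mem_map_of_mem hp) _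
          (List.mem_append_right _ (haQ p hw).2) rfl
      · exact (haQ p hw).1 (hdY' p hp)
  · intro w hw
    rcases List.mem_append.1 hw with hw | hw
    · rcases List.mem_append.1 hw with hw | hw
      · right
        simp only [List.map_append]
        exact List.mem_append_left _ (List.mem_map_of_mem hw)
      · exact Or.inl (hdY' w hw)
    · right
      have := (haQ w hw).2
      simp only [List.map_append, List.map_cons]
      exact List.mem_append_right _ (List.mem_cons_of_mem _ (List.mem_append_right _ this))
  · simp only [List.length_append, List.length_cons, List.length_map]
    omega
  · simp only [List.length_append, List.length_cons]
    omega
  · intro hh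
    refine hdt ?_
    unfold Transversal at hh ⊢
    rw [List.map_append] at hh
    exact hh.of_append_right

/-- The `k`-th block of length `M` of a list. -/
def blk (M : ℕ) (k : ℕ) (l : List V) : List V := (l.drop (M * k)).take M

theorem blk_zero (M : ℕ) (l : List V) : blk M 0 l = l.take M := by simp [blk]

theorem blk_succ (M k : ℕ) (l : List V) : blk M (k + 1) l = blk M k (l.drop M) := by
  simp [blk, List.drop_drop, Nat.mul_succ, add_comm]

/-- The result of replacing the blocks of length `M` selected by `I` by means of `R`, and
shifting everything after each replaced block by the corresponding automorphism `α`. -/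
def rewrite (M : ℕ) (R : List V → List V) (α : List V → G ≃g G) :
    (b : ℕ) → List V → (Fin b → Bool) → List V
  | 0, _, _ => []
  | b + 1, l, I =>
    if I 0 then
      R (l.take M) ++ (rewrite M R α b (l.drop M) fun i => I i.succ).map (α (l.take M))
    else l.take M ++ rewrite M R α b (l.drop M) fun i => I i.succ

/-! ### Rewriting several blocks at once, and decoding the result -/

section Rewrite

variable {A : Subgroup (G ≃g G)} {Y : List V → Set V} {m r M : ℕ} {Bad : List V → Prop}
  {R : List V → List V} {α : List V → G ≃g G}

theorem rewrite_walk (hR : ∀ B, Bad B → IsSurgery A (Y B) m r B (R B) (α B)) (b : ℕ) (v : V)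
    (l : List V) (I : Fin b → Bool) (hl : IsWalkFrom G v l)
    (hI : ∀ k : Fin b, I k → Bad (blk M k l)) : IsWalkFrom G v (rewrite M R α b l I) := by
  induction b generalizing v l with
  | zero => simp [rewrite]
  | succ b ih =>
    have hl' := hl
    rw [← List.take_append_drop M l, isWalkFrom_append] at hl'
    have h := ih (endpt v (l.take M)) (l.drop M) (fun i => I i.succ) hl'.2 (fun k hk => by
      have := hI k.succ hk
      rwa [Fin.val_succ, blk_succ] at this)
    rw [rewrite]
    split_ifs with h0
    · have hB := hI 0 h0
      rw [Fin.val_zero, blk_zero] at hB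
      have := (hR _ hB).walk v hl'.1
      rw [isWalkFrom_append, this.2, isWalkFrom_map]
      exact ⟨this.1, h⟩
    · rw [isWalkFrom_append]
      exact ⟨hl'.1, h⟩

theorem rewrite_length (hR : ∀ B, Bad B → IsSurgery A (Y B) m r B (R B) (α B)) (b : ℕ)
    (l : List V) (I : Fin b → Bool) (hI : ∀ k : Fin b, I k → Bad (blk M k l)) :
    (rewrite M R α b l I).length ≤ M * b + r * (∑ k, if I k then 1 else 0) := by
  induction b generalizing l with
  | zero => simp [rewrite]
  | succ b ih =>
    have h := ih (l.drop M) (fun i => I i.succ) (fun k hk => by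
      have := hI k.succ hk
      rwa [Fin.val_succ, blk_succ] at this)
    have hlen : (l.take M).length ≤ M := List.length_take_le _ _
    rw [rewrite, Fin.sum_univ_succ]
    split_ifs with h0
    · have hB := hI 0 h0
      rw [Fin.val_zero, blk_zero] at hB
      have := (hR _ hB).length
      rw [List.length_append, List.length_map]
      nlinarith
    · rw [List.length_append]
      nlinarith

/-- This is the information about the rewritten tail that `rewrite_nodup` needs. It is phrased
through orbits and the sets `Y`, both of which are insensitive to the accumulated shifts in `A`. -/
theorem rewrite_mem (hR : ∀ B, Bad B → IsSurgery A (Y B) m r B (R B) (α B))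
    (hY : ∀ B, ∀ a ∈ A, ∀ w, a w ∈ Y B ↔ w ∈ Y B) (b : ℕ)
    (l : List V) (I : Fin b → Bool) (hI : ∀ k : Fin b, I k → Bad (blk M k l)) :
    ∀ w ∈ rewrite M R α b l I,
      orb A w ∈ l.map (orb A) ∨ ∃ k : Fin b, I k ∧ w ∈ Y (blk M k l) := by
  induction b generalizing l with
  | zero => simp [rewrite]
  | succ b ih =>
    have h := ih (l.drop M) (fun i => I i.succ) (fun k hk => by
      have := hI k.succ hk
      rwa [Fin.val_succ, blk_succ] at this)
    have h' : ∀ w ∈ rewrite M R α b (l.drop M) (fun i => I i.succ),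
        orb A w ∈ l.map (orb A) ∨ ∃ k : Fin (b + 1), I k ∧ w ∈ Y (blk M k l) := by
      intro w hw
      rcases h w hw with h | ⟨k, hk, hkw⟩
      · left
        rw [List.map_drop] at h
        exact List.mem_of_mem_drop h
      · right
        refine ⟨k.succ, hk, ?_⟩
        rwa [Fin.val_succ, blk_succ]
    have htake : ∀ w, orb A w ∈ (l.take M).map (orb A) → orb A w ∈ l.map (orb A) := by
      intro w hw
      rw [List.map_take] at hw
      exact List.mem_of_mem_take hw
    intro w hw
    rw [rewrite] at hw
    split_ifs at hw with h0
    · have hB := hI 0 h0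
      rw [Fin.val_zero, blk_zero] at hB
      rcases List.mem_append.1 hw with hw | hw
      · rcases (hR _ hB).sub w hw with h1 | h1
        · right
          refine ⟨0, h0, ?_⟩
          rwa [Fin.val_zero, blk_zero]
        · exact Or.inl (htake w h1)
      · obtain ⟨u, hu, rfl⟩ := List.mem_map.1 hw
        rw [orb_apply (hR _ hB).mem]
        simp only [hY _ _ (hR _ hB).mem]
        exact h' u hu
    · rcases List.mem_append.1 hw with hw | hw
      · exact Or.inl (htake w (List.mem_map_of_mem hw))
      · exact h' w hw

/-- A collision between two blocks would have one of three forms: two original vertices in the same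
orbit, excluded by transversality; an original vertex on a detour in the `Y` of another block,
excluded by `hother`; or two detours meeting, excluded by `hdisj`. -/
theorem rewrite_nodup (hR : ∀ B, Bad B → IsSurgery A (Y B) m r B (R B) (α B))
    (hY : ∀ B, ∀ a ∈ A, ∀ w, a w ∈ Y B ↔ w ∈ Y B) (b : ℕ)
    (l : List V) (hlen : l.length = M * b) (I : Fin b → Bool)
    (hI : ∀ k : Fin b, I k → Bad (blk M k l))
    (ht : Transversal A l)
    (hother : ∀ j k : Fin b, j ≠ k → I k → ∀ w ∈ blk M j l, w ∉ Y (blk M k l))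
    (hdisj : ∀ j k : Fin b, j ≠ k → I j → I k → Disjoint (Y (blk M j l)) (Y (blk M k l))) :
    (rewrite M R α b l I).Nodup := by
  induction b generalizing l with
  | zero => simp [rewrite]
  | succ b ih =>
    have hI' : ∀ k : Fin b, I k.succ → Bad (blk M k (l.drop M)) := fun k hk => by
      have := hI k.succ hk
      rwa [Fin.val_succ, blk_succ] at this
    have ht' := ht
    unfold Transversal at ht'
    rw [← List.take_append_drop M l, List.map_append, List.nodup_append] at ht'
    obtain ⟨ht1, ht2, ht3⟩ := ht'
    have h := ih (l.drop M) (by rw [List.length_drop, hlen, Nat.mul_succ]; omega)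
      (fun i => I i.succ) hI' ht2
      (fun j k hjk hk => by
        have := hother j.succ k.succ (by simpa using hjk) hk
        simpa only [Fin.val_succ, blk_succ] using this)
      (fun j k hjk hj hk => by
        have := hdisj j.succ k.succ (by simpa using hjk) hj hk
        simpa only [Fin.val_succ, blk_succ] using this)
    have hm := rewrite_mem hR hY b (l.drop M) (fun i => I i.succ) hI'
    have hotherY : ∀ w ∈ l.take M, ∀ k : Fin b, I k.succ → w ∉ Y (blk M k (l.drop M)) := by
      intro w hw k hk
      have := hother 0 k.succ (Fin.succ_ne_zero k).symm hk w (by rwa [Fin.val_zero, blk_zero])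
      rwa [Fin.val_succ, blk_succ] at this
    rw [rewrite]
    split_ifs with h0
    · have hB := hI 0 h0
      rw [Fin.val_zero, blk_zero] at hB
      have hS := hR _ hB
      rw [List.nodup_append]
      refine ⟨hS.nodup ht1, h.map (α (l.take M)).injective, ?_⟩
      rintro w hw w' hw' hww
      obtain ⟨u, hu, rfl⟩ := List.mem_map.1 hw'
      subst hww
      rcases hS.sub _ hw with hw | hw
      · rw [hY _ _ hS.mem] at hw
        rcases hm u hu with hu | ⟨k, hk, hu⟩
        · obtain ⟨u', hu', huu⟩ := List.mem_map.1 hu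
          obtain ⟨a, ha, rfl⟩ := orb_eq_iff.1 huu
          rw [← hY _ a ha] at hw
          -- The translated vertex `a u` is the entry of index `i` after the first block, hence
          -- belongs to the block of index `i / M` there; that block would then visit the `Y` of the
          -- first block.
          have hpos : 0 < M := by
            rcases Nat.eq_zero_or_pos M with rfl | h
            · rw [Nat.zero_mul, List.length_eq_zero_iff] at hlen
              simp [hlen] at hu'
            · exact h
          obtain ⟨i, hi, hiu⟩ := List.mem_iff_getElem.1 hu'
          rw [List.length_drop, hlen, Nat.mul_succ, Nat.add_sub_cancel] at hi
          have hib : i / M < b := Nat.div_lt_of_lt_mul hi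
          refine hother (Fin.succ ⟨i / M, hib⟩) 0 (Fin.succ_ne_zero _) h0 (a u) ?_
            (by rwa [Fin.val_zero, blk_zero])
          rw [Fin.val_succ, blk_succ, blk, List.mem_iff_getElem]
          have hdm := Nat.div_add_mod i M
          have hml := Nat.mod_lt i hpos
          refine ⟨i % M, ?_, ?_⟩
          · rw [List.length_take, List.length_drop, List.length_drop, hlen, Nat.mul_succ]
            refine lt_min hml ?_
            change i % M < M * b + M - M - M * (i / M)
            omega
          · rw [List.getElem_take, List.getElem_drop, ← hiu]
            congr 1
        · have hd := hdisj 0 k.succ (Fin.succ_ne_zero _).symm h0 hk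
          rw [Fin.val_zero, blk_zero, Fin.val_succ, blk_succ] at hd
          exact Set.disjoint_left.1 hd hw hu
      · rw [orb_apply hS.mem] at hw
        rcases hm u hu with hu | ⟨k, hk, hu⟩
        · exact ht3 _ hw _ hu rfl
        · obtain ⟨u', hu', huu⟩ := List.mem_map.1 hw
          obtain ⟨a, ha, rfl⟩ := orb_eq_iff.1 huu
          exact hotherY _ hu' k hk ((hY _ a ha _).2 hu)
    · rw [List.nodup_append]
      refine ⟨List.Nodup.of_map _ ht1, h, ?_⟩
      rintro w hw _ hu rfl
      rcases hm w hu with hu | ⟨k, hk, hu⟩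
      · exact ht3 _ (List.mem_map_of_mem hw) _ hu rfl
      · exact hotherY _ hw k hk hu

theorem not_transversal_of_prefix {P l : List V} (h : P <+: l) (hP : ¬ Transversal A P) :
    ¬ Transversal A l := by
  obtain ⟨Q, rfl⟩ := h
  intro hh
  unfold Transversal at hh
  rw [List.map_append] at hh
  exact hP hh.of_append_left

theorem sum_bool_succ {β : Type*} [AddCommMonoid β] (b : ℕ) (f : (Fin (b + 1) → Bool) → β) :
    ∑ I, f I = (∑ I : Fin b → Bool, f (Fin.cons true I)) + ∑ I, f (Fin.cons false I) := by
  rw [← (Fin.consEquiv fun _ => Bool).sum_comp, Fintype.sum_prod_type]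
  simp [Fin.consEquiv]

/-- Weighting each replaced block by `c`, the total weight of the transversal block walks that are
rewritten to a given list is at most `1`, if there are at most `c⁻¹` walks with `M` steps. -/
theorem sum_rewrite_le_one [G.LocallyFinite] (hM : M = m + r)
    (hR : ∀ B, Bad B → IsSurgery A (Y B) m r B (R B) (α B))
    {c : ℝ} (hc : 0 ≤ c) (hcM : ∀ v, ((walks G v M).card : ℝ) * c ≤ 1) (b : ℕ) (v : V)
    (w : List V) :
    ∑ l ∈ walks G v (M * b), ∑ I : Fin b → Bool,
      (if (∀ k : Fin b, Transversal A (blk M k l) ∧ (I k → Bad (blk M k l))) ∧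
        rewrite M R α b l I = w then ∏ k, (if I k then c else 1) else 0) ≤ 1 := by
  induction b generalizing v w with
  | zero =>
    rw [Nat.mul_zero]
    simp only [walks, Finset.sum_singleton]
    rw [Fintype.sum_unique]
    split_ifs <;> simp
  | succ b ih =>
    rw [show M * (b + 1) = M + M * b by ring, sum_walks_add]
    have hwt : ∀ I : Fin b → Bool, 0 ≤ ∏ k, (if I k then c else 1) := fun I =>
      Finset.prod_nonneg fun k _ => by split_ifs <;> linarith
    have htake : ∀ l₁ ∈ walks G v M, ∀ l₂ : List V, (l₁ ++ l₂).take M = l₁ ∧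
        (l₁ ++ l₂).drop M = l₂ := by
      intro l₁ h₁ l₂
      have := ((mem_walks G).1 h₁).2
      constructor
      · rw [← this]; simp
      · rw [← this]; simp
    -- The first `M` entries of `w` reveal whether the first block was replaced: an untouched block
    -- is transversal, while a replaced one leaves an orbit repetition within its first `m + r = M`
    -- entries. In the first case the block is `w.take M` itself.
    by_cases hw : Transversal A (w.take M)
    · have key : ∀ l₁ ∈ walks G v M, ∑ l₂ ∈ walks G (endpt v l₁) (M * b),
          ∑ I : Fin (b + 1) → Bool,
          (if (∀ k : Fin (b + 1), Transversal A (blk M k (l₁ ++ l₂)) ∧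
              (I k → Bad (blk M k (l₁ ++ l₂)))) ∧
            rewrite M R α (b + 1) (l₁ ++ l₂) I = w then ∏ k, (if I k then c else 1) else 0)
          ≤ if w.take M = l₁ then 1 else 0 := by
        intro l₁ h₁
        split_ifs with hl₁
        · refine le_trans ?_ (ih (endpt v l₁) (w.drop M))
          refine Finset.sum_le_sum fun l₂ h₂ => ?_
          rw [sum_bool_succ]
          refine le_trans (add_le_of_nonpos_left (Finset.sum_nonpos fun I _ => ?_))
            (Finset.sum_le_sum fun I _ => ?_)
          · refine (if_neg ?_).le
            rintro ⟨h1, h2⟩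
            have hB := (h1 0).2 rfl
            rw [Fin.val_zero, blk_zero, (htake l₁ h₁ l₂).1] at hB
            simp only [rewrite, Fin.cons_zero, if_true, (htake l₁ h₁ l₂).1] at h2
            obtain ⟨P, hP1, hP2, hP3⟩ := (hR _ hB).repeats
            refine not_transversal_of_prefix (List.prefix_take_iff.2 ⟨?_, hM ▸ hP2⟩) hP3 hw
            rw [← h2]
            exact hP1.trans (List.prefix_append _ _)
          · by_cases hh : (∀ k : Fin (b + 1), Transversal A (blk M k (l₁ ++ l₂)) ∧
              ((Fin.cons false I : Fin (b + 1) → Bool) k → Bad (blk M k (l₁ ++ l₂)))) ∧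
                rewrite M R α (b + 1) (l₁ ++ l₂) (Fin.cons false I) = w
            · rw [if_pos hh, if_pos, Fin.prod_univ_succ]
              · simp
              · obtain ⟨h1, h2⟩ := hh
                constructor
                · intro k
                  have := h1 k.succ
                  rwa [Fin.val_succ, blk_succ, (htake l₁ h₁ l₂).2, Fin.cons_succ] at this
                · simp only [rewrite, Fin.cons_zero, (htake l₁ h₁ l₂).1, (htake l₁ h₁ l₂).2,
                    Fin.cons_succ] at h2
                  rw [← h2]
                  simp only [Bool.false_eq_true, if_false]
                  have := ((mem_walks G).1 h₁).2
                  rw [← this]; simp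
            · rw [if_neg hh]
              split_ifs
              · exact hwt I
              · exact le_rfl
        · refine Finset.sum_nonpos fun l₂ h₂ => Finset.sum_nonpos fun I _ => (if_neg ?_).le
          rintro ⟨h1, h2⟩
          rw [rewrite, (htake l₁ h₁ l₂).1] at h2
          split_ifs at h2 with h0
          · have hB := (h1 0).2 h0
            rw [Fin.val_zero, blk_zero, (htake l₁ h₁ l₂).1] at hB
            obtain ⟨P, hP1, hP2, hP3⟩ := (hR _ hB).repeats
            refine not_transversal_of_prefix (List.prefix_take_iff.2 ⟨?_, hM ▸ hP2⟩) hP3 hw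
            rw [← h2]
            exact hP1.trans (List.prefix_append _ _)
          · refine hl₁ ?_
            rw [← h2]
            exact (htake l₁ h₁ _).1
      refine (Finset.sum_le_sum key).trans ?_
      rw [Finset.sum_ite_eq]
      split_ifs <;> norm_num
    -- Here the first block was replaced and cannot be read off from `w`. Every candidate `l₁`
    -- determines the remaining rewritten walk and contributes at most `c`, and `hcM` bounds the sum
    -- over all candidates.
    · have key : ∀ l₁ ∈ walks G v M, ∑ l₂ ∈ walks G (endpt v l₁) (M * b),
          ∑ I : Fin (b + 1) → Bool,
          (if (∀ k : Fin (b + 1), Transversal A (blk M k (l₁ ++ l₂)) ∧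
              (I k → Bad (blk M k (l₁ ++ l₂)))) ∧
            rewrite M R α (b + 1) (l₁ ++ l₂) I = w then ∏ k, (if I k then c else 1) else 0)
          ≤ c := by
        intro l₁ h₁
        refine le_trans ?_ (mul_le_of_le_one_right hc
          (ih (endpt v l₁) ((w.drop (R l₁).length).map (α l₁).symm)))
        rw [Finset.mul_sum]
        refine Finset.sum_le_sum fun l₂ h₂ => ?_
        rw [sum_bool_succ, Finset.mul_sum]
        refine le_trans (add_le_of_nonpos_right (Finset.sum_nonpos fun I _ => ?_))
            (Finset.sum_le_sum fun I _ => ?_)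
        · refine (if_neg ?_).le
          rintro ⟨h1, h2⟩
          have hT := (h1 0).1
          rw [Fin.val_zero, blk_zero, (htake l₁ h₁ l₂).1] at hT
          simp only [rewrite, Fin.cons_zero, (htake l₁ h₁ l₂).1, Bool.false_eq_true,
            if_false] at h2
          refine hw ?_
          rw [← h2, (htake l₁ h₁ _).1]
          exact hT
        · by_cases hh : (∀ k : Fin (b + 1), Transversal A (blk M k (l₁ ++ l₂)) ∧
              ((Fin.cons true I : Fin (b + 1) → Bool) k → Bad (blk M k (l₁ ++ l₂)))) ∧
                rewrite M R α (b + 1) (l₁ ++ l₂) (Fin.cons true I) = w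
          · rw [if_pos hh, if_pos, Fin.prod_univ_succ]
            · simp
            · obtain ⟨h1, h2⟩ := hh
              constructor
              · intro k
                have := h1 k.succ
                rwa [Fin.val_succ, blk_succ, (htake l₁ h₁ l₂).2, Fin.cons_succ] at this
              · simp only [rewrite, Fin.cons_zero, (htake l₁ h₁ l₂).1, (htake l₁ h₁ l₂).2,
                  Fin.cons_succ, if_true] at h2
                rw [← h2]
                simp [Function.comp_def]
          · rw [if_neg hh]
            split_ifs
            · exact mul_nonneg hc (hwt I)
            · simp
      refine (Finset.sum_le_sum key).trans ?_
      rw [Finset.sum_const, nsmul_eq_mul]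
      exact hcM v

end Rewrite

end Surgery

/-! ### Translates of a pattern and the number of visits to them -/

section Visits

open scoped Classical

variable {V : Type*} {G : SimpleGraph V}

theorem Transversal.append {A : Subgroup (G ≃g G)} {l l' : List V}
    (h : Transversal A (l ++ l')) : Transversal A l ∧ Transversal A l' := by
  unfold Transversal at h ⊢
  rw [List.map_append] at h
  exact ⟨h.of_append_left, h.of_append_right⟩

theorem Transversal.sublist {A : Subgroup (G ≃g G)} {l l' : List V}
    (h : Transversal A l) (hl : l'.Sublist l) : Transversal A l' :=
  List.Nodup.sublist (hl.map _) h

/-- `Γ` normalizes `A`. -/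
def Normalizes (Γ A : Subgroup (G ≃g G)) : Prop := ∀ γ ∈ Γ, ∀ a ∈ A, γ * a * γ⁻¹ ∈ A

theorem Normalizes.inv_mem {Γ A : Subgroup (G ≃g G)} (hN : Normalizes Γ A) {γ a : G ≃g G}
    (hγ : γ ∈ Γ) (ha : a ∈ A) : γ⁻¹ * a * γ ∈ A := by
  simpa using hN γ⁻¹ (Γ.inv_mem hγ) a ha

theorem Normalizes.orb_apply_eq_iff {Γ A : Subgroup (G ≃g G)} (hN : Normalizes Γ A)
    {γ : G ≃g G} (hγ : γ ∈ Γ) (v w : V) : orb A (γ v) = orb A (γ w) ↔ orb A v = orb A w := by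
  rw [orb_eq_iff, orb_eq_iff]
  constructor
  · rintro ⟨a, ha, h⟩
    refine ⟨γ⁻¹ * a * γ, hN.inv_mem hγ ha, ?_⟩
    change γ.symm (a (γ w)) = v
    rw [h]
    simp
  · rintro ⟨a, ha, rfl⟩
    refine ⟨γ * a * γ⁻¹, hN γ hγ a ha, ?_⟩
    change γ (a (γ.symm (γ w))) = _
    simp

theorem Normalizes.transversal_map {Γ A : Subgroup (G ≃g G)} (hN : Normalizes Γ A)
    {γ : G ≃g G} (hγ : γ ∈ Γ) (l : List V) : Transversal A (l.map γ) ↔ Transversal A l := by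
  unfold Transversal
  induction l with
  | nil => simp
  | cons v l ih =>
    simp only [List.map_cons, List.nodup_cons, ih]
    refine and_congr (not_congr ?_) Iff.rfl
    simp [hN.orb_apply_eq_iff hγ]

/-- The image of `S` under `γ`. -/
def translate (S : Set V) (γ : G ≃g G) : Set V := {w | γ.symm w ∈ S}

theorem apply_mem_translate {S : Set V} {γ : G ≃g G} {w : V} : γ w ∈ translate S γ ↔ w ∈ S := by
  simp [translate]

/-- Normality enters here: elements of `Γ` permute the `A`-orbits, so detours, their orbit
repetitions and the finiteness of the set of orbits all carry over. -/
theorem Pattern.map {Γ A : Subgroup (G ≃g G)} (hN : Normalizes Γ A) {S : Set V} {r : ℕ}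
    (hS : Pattern A S r) {γ : G ≃g G} (hγ : γ ∈ Γ) : Pattern A (translate S γ) r where
  inv a ha w := by
    change γ.symm (a w) ∈ S ↔ γ.symm w ∈ S
    rw [← hS.inv _ (hN.inv_mem hγ ha) (γ.symm w)]
    change _ ↔ γ.symm (a (γ (γ.symm w))) ∈ S
    simp
  nonempty := by
    obtain ⟨w, hw⟩ := hS.nonempty
    exact ⟨γ w, apply_mem_translate.2 hw⟩
  finite := by
    have hf : (orb A '' S).Finite := hS.finite
    let f : MulAction.orbitRel.Quotient A V → MulAction.orbitRel.Quotient A V :=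
      fun o => orb A (γ o.out)
    refine (hf.image f).subset ?_
    rintro _ ⟨w, hw, rfl⟩
    refine ⟨_, ⟨γ.symm w, hw, rfl⟩, ?_⟩
    change orb A (γ (orb A (γ.symm w)).out) = orb A w
    have h1 : orb A (orb A (γ.symm w)).out = orb A (γ.symm w) := Quotient.out_eq' _
    rw [(hN.orb_apply_eq_iff hγ _ _).2 h1]
    simp
  detour x hx y hy := by
    obtain ⟨d, a, ha, h1, h2, h3, h4, h5, h6⟩ := hS.detour _ hx _ hy
    refine ⟨d.map γ, γ * a * γ⁻¹, hN γ hγ a ha, ?_, ?_, ?_, ?_, ?_, ?_⟩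
    · rw [← isWalkFrom_map γ] at h1
      simpa using h1
    · have := endpt_map γ (γ.symm x) d
      rw [h2, RelIso.apply_symm_apply] at this
      exact this
    · have := h3.map γ.injective
      simpa using this
    · intro w hw
      obtain ⟨u, hu, rfl⟩ := List.mem_map.1 hw
      exact apply_mem_translate.2 (h4 u hu)
    · rw [← hN.transversal_map hγ] at h5
      simpa using h5
    · simpa using h6

/-- The number of vertices in `l` that lie in the image of `S` under `γ`. -/
noncomputable def visits (S : Set V) (γ : G ≃g G) (l : List V) : ℕ :=
  l.countP fun w => w ∈ translate S γ

/-- Every image of `S` under `Γ` is visited fewer than `K` times by `l`. -/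
def Free (Γ : Subgroup (G ≃g G)) (S : Set V) (K : ℕ) (l : List V) : Prop :=
  ∀ γ ∈ Γ, visits S γ l < K

theorem Free.sublist {Γ : Subgroup (G ≃g G)} {S : Set V} {K : ℕ} {l l' : List V}
    (h : Free Γ S K l) (hl : l'.Sublist l) : Free Γ S K l' :=
  fun γ hγ => lt_of_le_of_lt hl.countP_le (h γ hγ)

theorem free_map {Γ : Subgroup (G ≃g G)} {S : Set V} {K : ℕ} {g : G ≃g G} (hg : g ∈ Γ)
    (l : List V) : Free Γ S K (l.map g) ↔ Free Γ S K l := by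
  have key : ∀ γ : G ≃g G, visits S γ (l.map g) = visits S (g⁻¹ * γ) l := by
    intro γ
    unfold visits
    rw [List.countP_map]
    rfl
  constructor
  · intro h γ hγ
    have := h (g * γ) (Γ.mul_mem hg hγ)
    rwa [key, inv_mul_cancel_left] at this
  · intro h γ hγ
    rw [key]
    exact h _ (Γ.mul_mem (Γ.inv_mem hg) hγ)

/-- If the vertices of `S` lie in `K` orbits, a transversal walk visits each image of `S` at most
`K` times. -/
theorem Pattern.free_of_transversal {Γ A : Subgroup (G ≃g G)} (hN : Normalizes Γ A) {S : Set V}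
    {r : ℕ} (hS : Pattern A S r) {l : List V} (hl : Transversal A l) :
    Free Γ S (hS.finite.toFinset.card + 1) l := by
  intro γ hγ
  rw [Nat.lt_succ_iff, visits, List.countP_eq_length_filter]
  set l' := l.filter fun w => w ∈ translate S γ with hl'
  have h1 : Transversal A (l'.map γ.symm) :=
    (hN.transversal_map (Γ.inv_mem hγ) l').2 (hl.sublist List.filter_sublist)
  have h2 : ((l'.map γ.symm).map (orb A)).toFinset ⊆ hS.finite.toFinset := by
    intro o ho
    rw [List.mem_toFinset] at ho
    obtain ⟨u, hu, rfl⟩ := List.mem_map.1 ho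
    obtain ⟨w, hw, rfl⟩ := List.mem_map.1 hu
    rw [Set.Finite.mem_toFinset]
    refine ⟨_, ?_, rfl⟩
    have := (List.mem_filter.1 hw).2
    exact of_decide_eq_true this
  have h3 := Finset.card_le_card h2
  rw [List.toFinset_card_of_nodup h1] at h3
  simpa using h3

theorem blk_sublist (M k : ℕ) (l : List V) : (blk M k l).Sublist l :=
  (List.take_sublist _ _).trans (List.drop_sublist _ _)

theorem countP_blk_add_le (p : V → Bool) (M : ℕ) (l : List V) {j k : ℕ} (hjk : j ≠ k) :
    (blk M j l).countP p + (blk M k l).countP p ≤ l.countP p := by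
  wlog h : j < k generalizing j k
  · rw [add_comm]
    exact this hjk.symm (by omega)
  have h1 : (blk M j l).Sublist (l.take (M * k)) := by
    have : blk M j l = (l.take (M * j + M)).drop (M * j) := by
      rw [blk, List.drop_take, Nat.add_sub_cancel_left]
    rw [this]
    refine (List.drop_sublist _ _).trans (List.take_sublist_take_left ?_)
    rw [← Nat.mul_succ]
    exact Nat.mul_le_mul_left M h
  have h2 : (blk M k l).Sublist (l.drop (M * k)) := List.take_sublist _ _
  calc _ ≤ (l.take (M * k)).countP p + (l.drop (M * k)).countP p :=
        add_le_add h1.countP_le h2.countP_le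
    _ = l.countP p := by rw [← List.countP_append, List.take_append_drop]

/-- The images of `u` under the elements of `Γ` that move `x` to `y`. -/
theorem finite_transporter_image [G.LocallyFinite] (hconn : G.Connected)
    (Γ : Subgroup (G ≃g G)) (x u : V) : ∀ y, {w | ∃ γ ∈ Γ, γ x = y ∧ γ u = w}.Finite := by
  obtain ⟨p⟩ := hconn.preconnected x u
  induction p with
  | nil =>
    intro y
    refine (Set.finite_singleton y).subset ?_
    rintro w ⟨γ, _, h1, h2⟩
    exact h2.symm.trans h1
  | @cons x x' u hadj p ih =>
    intro y
    refine ((Set.toFinite (G.neighborSet y)).biUnion fun y' _ => ih y').subset ?_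
    rintro w ⟨γ, hγ, h1, h2⟩
    simp only [Set.mem_iUnion]
    refine ⟨γ x', ?_, γ, hγ, rfl, h2⟩
    rw [SimpleGraph.mem_neighborSet, ← h1]
    exact γ.map_adj_iff.2 hadj

/-- If `γ S` meets `S`, composing `γ` with elements of `A` on both sides makes it carry one chosen
orbit representative in `S` to another. By `finite_transporter_image` each representative then has
finitely many possible images, so all orbits of `γ S` belong to one finite set `H`. An `A`-invariant
set is determined by its orbits, so only finitely many translates occur. -/
theorem finite_meeting_translates [G.LocallyFinite] (hconn : G.Connected)
    {Γ A : Subgroup (G ≃g G)} (hAΓ : A ≤ Γ) (hN : Normalizes Γ A) {S : Set V} {r : ℕ}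
    (hS : Pattern A S r) : {Y | ∃ γ ∈ Γ, Y = translate S γ ∧ (Y ∩ S).Nonempty}.Finite := by
  set F := orb A '' S with hF
  have hout : ∀ w : V, orb A (orb A w).out = orb A w := fun w => Quotient.out_eq' _
  let H : Set (MulAction.orbitRel.Quotient A V) :=
    ⋃ o₁ ∈ F, ⋃ o₂ ∈ F, ⋃ o ∈ F, orb A '' {w | ∃ γ ∈ Γ, γ o₁.out = o₂.out ∧ γ o.out = w}
  have hH : H.Finite := hS.finite.biUnion fun o₁ _ => hS.finite.biUnion fun o₂ _ =>
    hS.finite.biUnion fun o _ => (finite_transporter_image hconn Γ _ _ _).image _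
  refine (hH.finite_subsets.image fun T => orb A ⁻¹' T).subset ?_
  rintro Y ⟨γ, hγ, rfl, w, hwY, hwS⟩
  have hY := hS.map hN hγ
  refine ⟨orb A '' translate S γ, ?_, ?_⟩
  · rintro _ ⟨u, hu, rfl⟩
    obtain ⟨a₂, ha₂, h₂⟩ := orb_eq_iff.1 (hout w)
    obtain ⟨a₁, ha₁, h₁⟩ := orb_eq_iff.1 (hout (γ.symm w)).symm
    simp only [H, Set.mem_iUnion]
    refine ⟨orb A (γ.symm w), ⟨_, hwY, rfl⟩, orb A w, ⟨_, hwS, rfl⟩,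
      orb A (a₁⁻¹ (γ.symm u)), ⟨_, (hS.inv _ (A.inv_mem ha₁) _).2 hu, rfl⟩, ?_⟩
    refine ⟨_, ⟨a₂ * γ * a₁, ?_, ?_, rfl⟩, ?_⟩
    · exact Γ.mul_mem (Γ.mul_mem (hAΓ ha₂) hγ) (hAΓ ha₁)
    · change a₂ (γ (a₁ _)) = _
      rw [h₁, RelIso.apply_symm_apply, h₂]
    · change orb A (a₂ (γ (a₁ _))) = _
      rw [orb_apply ha₂]
      have h3 : orb A (a₁ (orb A (a₁⁻¹ (γ.symm u))).out) = orb A (γ.symm u) := by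
        rw [orb_apply ha₁, hout, orb_apply (A.inv_mem ha₁)]
      rw [(hN.orb_apply_eq_iff hγ _ _).2 h3]
      simp
  · ext u
    constructor
    · rintro ⟨u', hu', h⟩
      obtain ⟨a, ha, rfl⟩ := orb_eq_iff.1 h
      exact (hY.inv a ha u).1 hu'
    · exact fun hu => ⟨u, hu, rfl⟩

/-- Pulling back by `γ₀` turns translates meeting `γ₀ S` into translates meeting `S`, so one
constant serves for all `γ₀`. -/
theorem exists_meeting_bound [G.LocallyFinite] (hconn : G.Connected)
    {Γ A : Subgroup (G ≃g G)} (hAΓ : A ≤ Γ) (hN : Normalizes Γ A) {S : Set V} {r : ℕ}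
    (hS : Pattern A S r) : ∃ D : ℕ, ∀ γ₀ ∈ Γ, ∀ T : Finset (Set V),
      (∀ Y ∈ T, ∃ γ ∈ Γ, Y = translate S γ ∧ (Y ∩ translate S γ₀).Nonempty) → T.card ≤ D := by
  have hfin := finite_meeting_translates hconn hAΓ hN hS
  refine ⟨hfin.toFinset.card, fun γ₀ hγ₀ T hT => ?_⟩
  refine Finset.card_le_card_of_injOn (fun Y => γ₀ ⁻¹' Y) ?_ ?_
  · intro Y hYT
    obtain ⟨γ, hγ, rfl, w, hw, hw₀⟩ := hT Y hYT
    simp only [Set.Finite.coe_toFinset, Set.mem_ofPred_eq]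
    refine ⟨γ₀⁻¹ * γ, Γ.mul_mem (Γ.inv_mem hγ₀) hγ, rfl, γ₀.symm w, ?_, hw₀⟩
    simpa using hw
  · intro Y _ Y' _ h
    exact (Set.preimage_injective.2 γ₀.surjective) h

/-- The sum over walks consisting of `b` blocks of a product of weights of the blocks. -/
theorem sum_prod_blk_le [G.LocallyFinite] (M : ℕ) (g : List V → ℝ) (hg : ∀ B, 0 ≤ g B) {θ : ℝ}
    (hθ : ∀ v, ∑ B ∈ walks G v M, g B ≤ θ) (b : ℕ) (v : V) :
    ∑ l ∈ walks G v (M * b), ∏ k : Fin b, g (blk M k l) ≤ θ ^ b := by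
  have hθ0 : 0 ≤ θ := (Finset.sum_nonneg fun B _ => hg B).trans (hθ v)
  induction b generalizing v with
  | zero => simp [walks]
  | succ b ih =>
    rw [show M * (b + 1) = M + M * b by ring, sum_walks_add, pow_succ']
    calc _ = ∑ B ∈ walks G v M, g B * ∑ l ∈ walks G (endpt v B) (M * b),
          ∏ k : Fin b, g (blk M k l) := by
          refine Finset.sum_congr rfl fun B hB => ?_
          rw [Finset.mul_sum]
          refine Finset.sum_congr rfl fun l _ => ?_
          have hlen := ((mem_walks G).1 hB).2
          rw [Fin.prod_univ_succ]
          congr 1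
          · rw [Fin.val_zero, blk_zero, ← hlen]; simp
          · refine Finset.prod_congr rfl fun k _ => ?_
            rw [Fin.val_succ, blk_succ, ← hlen]; simp
      _ ≤ ∑ B ∈ walks G v M, g B * θ ^ b :=
          Finset.sum_le_sum fun B _ => mul_le_mul_of_nonneg_left (ih _) (hg B)
      _ ≤ θ * θ ^ b := by
          rw [← Finset.sum_mul]
          exact mul_le_mul_of_nonneg_right (hθ v) (pow_nonneg hθ0 _)

end Visits

/-! ### Bad blocks and the weighted comparison with self-avoiding walks -/

section Blocks

open scoped Classical

variable {V : Type*} {G : SimpleGraph V}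

/-- Some image of `S` is visited at least `K` times in the first `m` steps of `B`. -/
def Bad (Γ : Subgroup (G ≃g G)) (S : Set V) (K m : ℕ) (B : List V) : Prop :=
  ¬ Free Γ S K (B.take m)

/-- An element of `Γ` such that the image of `S` under it is visited at least `K` times in the
first `m` steps of `B`, if there is one. -/
noncomputable def badElt (Γ : Subgroup (G ≃g G)) (S : Set V) (K m : ℕ) (B : List V) : G ≃g G :=
  if h : ∃ γ ∈ Γ, K ≤ visits S γ (B.take m) then h.choose else 1

theorem badElt_mem (Γ : Subgroup (G ≃g G)) (S : Set V) (K m : ℕ) (B : List V) :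
    badElt Γ S K m B ∈ Γ := by
  unfold badElt
  split_ifs with h
  · exact h.choose_spec.1
  · exact Γ.one_mem

theorem Bad.le_visits {Γ : Subgroup (G ≃g G)} {S : Set V} {K m : ℕ} {B : List V}
    (h : Bad Γ S K m B) : K ≤ visits S (badElt Γ S K m B) (B.take m) := by
  have h' : ∃ γ ∈ Γ, K ≤ visits S γ (B.take m) := by
    unfold Bad Free at h
    push Not at h
    exact h
  unfold badElt
  rw [dif_pos h']
  exact h'.choose_spec.2

/-- A bad block already uses up all `K` visits that a `(K + 1)`-free walk may pay to its translate.
This is why the induction raises `K` by one at a time. -/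
theorem Bad.notMem {Γ : Subgroup (G ≃g G)} {S : Set V} {K m M : ℕ} {l : List V} {j k : ℕ}
    (hl : Free Γ S (K + 1) l) (hjk : j ≠ k) (hk : Bad Γ S K m (blk M k l)) :
    ∀ w ∈ blk M j l, w ∉ translate S (badElt Γ S K m (blk M k l)) := by
  intro w hw hwY
  have h1 := hk.le_visits
  have h2 : visits S (badElt Γ S K m (blk M k l)) ((blk M k l).take m)
      ≤ visits S (badElt Γ S K m (blk M k l)) (blk M k l) :=
    (List.take_sublist _ _).countP_le
  have h3 : 0 < visits S (badElt Γ S K m (blk M k l)) (blk M j l) :=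
    List.countP_pos_iff.2 ⟨w, hw, by simpa using hwY⟩
  have h4 := countP_blk_add_le
    (fun w => decide (w ∈ translate S (badElt Γ S K m (blk M k l)))) M l hjk
  have h5 := hl _ (badElt_mem Γ S K m (blk M k l))
  unfold visits at *
  omega

theorem Bad.exists_mem {Γ : Subgroup (G ≃g G)} {S : Set V} {K m : ℕ} {B : List V} (hK : 1 ≤ K)
    (h : Bad Γ S K m B) : ∃ w ∈ B.take m, w ∈ translate S (badElt Γ S K m B) := by
  obtain ⟨w, hw, h'⟩ := List.countP_pos_iff.1 (hK.trans h.le_visits)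
  exact ⟨w, hw, by simpa using h'⟩

/-- The indices of the bad blocks. -/
noncomputable def badSet (Γ : Subgroup (G ≃g G)) (S : Set V) (K m M b : ℕ) (l : List V) :
    Finset (Fin b) := Finset.univ.filter fun k => Bad Γ S K m (blk M k l)

/-- A positive fraction of the bad blocks can be chosen to have disjoint images of `S`. -/
theorem exists_disjoint_bad {Γ : Subgroup (G ≃g G)} {S : Set V} {K m M D : ℕ} (hK : 1 ≤ K)
    (hD : ∀ γ₀ ∈ Γ, ∀ T : Finset (Set V),
      (∀ Y ∈ T, ∃ γ ∈ Γ, Y = translate S γ ∧ (Y ∩ translate S γ₀).Nonempty) → T.card ≤ D)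
    (b : ℕ) (l : List V) (hl : Free Γ S (K + 1) l) :
    ∃ J ⊆ badSet Γ S K m M b l, (∀ j ∈ J, ∀ k ∈ J, j ≠ k →
      Disjoint (translate S (badElt Γ S K m (blk M j l)))
        (translate S (badElt Γ S K m (blk M k l)))) ∧
      (badSet Γ S K m M b l).card ≤ D * J.card := by
  set Y : Fin b → Set V := fun k => translate S (badElt Γ S K m (blk M k l)) with hY
  have hne : ∀ k ∈ badSet Γ S K m M b l, (Y k).Nonempty := by
    intro k hk
    obtain ⟨w, -, hw⟩ := Bad.exists_mem hK (Finset.mem_filter.1 hk).2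
    exact ⟨w, hw⟩
  -- Block `j` visits its own translate `Y j`, whereas no block other than `k` visits `Y k`. Hence
  -- the bound `D` on sets is also a bound on block indices.
  have hinj : ∀ j ∈ badSet Γ S K m M b l, ∀ k ∈ badSet Γ S K m M b l, Y j = Y k → j = k := by
    intro j hj k hk h
    by_contra hjk
    obtain ⟨w, hw, hwY⟩ := Bad.exists_mem hK (Finset.mem_filter.1 hj).2
    refine Bad.notMem hl (fun h => hjk (Fin.ext h)) (Finset.mem_filter.1 hk).2 w
      (List.mem_of_mem_take hw) ?_
    change w ∈ Y k
    rw [← h]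
    exact hwY
  let P : Finset (Fin b) → Prop := fun J => J ⊆ badSet Γ S K m M b l ∧
    ∀ j ∈ J, ∀ k ∈ J, j ≠ k → Disjoint (Y j) (Y k)
  obtain ⟨J, hJ⟩ : ∃ J, Maximal P J := by
    have h0 : P ∅ := ⟨Finset.empty_subset _, by simp⟩
    obtain ⟨J, -, hJ⟩ := (Set.toFinite {J | P J}).exists_le_maximal h0
    exact ⟨J, hJ⟩
  refine ⟨J, hJ.prop.1, hJ.prop.2, ?_⟩
  -- By maximality of `J`, the translate of every bad block meets the translate of some block in
  -- `J`.
  have hcover : badSet Γ S K m M b l ⊆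
      J.biUnion fun j => (badSet Γ S K m M b l).filter fun k => (Y k ∩ Y j).Nonempty := by
    intro k hk
    by_contra hcon
    simp only [Finset.mem_biUnion, Finset.mem_filter, not_exists, not_and] at hcon
    have hd : ∀ j ∈ J, Disjoint (Y k) (Y j) := by
      intro j hj
      rw [Set.disjoint_iff_inter_eq_empty]
      exact Set.not_nonempty_iff_eq_empty.1 (hcon j hj hk)
    have hkJ : k ∉ J := fun h => hcon k h hk (by simpa using hne k hk)
    have hins : P (insert k J) := by
      refine ⟨Finset.insert_subset hk hJ.prop.1, ?_⟩
      intro i hi j hj hij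
      rcases Finset.mem_insert.1 hi with hi' | hi' <;> rcases Finset.mem_insert.1 hj with hj' | hj'
      · exact absurd (hi'.trans hj'.symm) hij
      · exact hi' ▸ hd j hj'
      · exact hj' ▸ (hd i hi').symm
      · exact hJ.prop.2 i hi' j hj' hij
    exact hkJ (hJ.le_of_ge hins (Finset.subset_insert k J) (Finset.mem_insert_self k J))
  calc (badSet Γ S K m M b l).card ≤ _ := Finset.card_le_card hcover
    _ ≤ J.card * D := Finset.card_biUnion_le_card_mul _ _ _ fun j hj => ?_
    _ = D * J.card := mul_comm _ _
  rw [← Finset.card_image_of_injOn (f := Y)]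
  · refine hD _ (badElt_mem Γ S K m (blk M j l)) _ ?_
    intro Z hZ
    obtain ⟨k, hk, rfl⟩ := Finset.mem_image.1 hZ
    exact ⟨_, badElt_mem Γ S K m (blk M k l), rfl, (Finset.mem_filter.1 hk).2⟩
  · intro i hi j hj hij
    exact hinj i (Finset.mem_filter.1 hi).1 j (Finset.mem_filter.1 hj).1 hij

theorem sum_bool_weight {b : ℕ} (J : Finset (Fin b)) (x : ℝ) :
    ∑ I : Fin b → Bool, (if ∀ k, I k → k ∈ J then ∏ k, (if I k then x else 1) else 0)
      = (1 + x) ^ J.card := by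
  have h1 : ∀ I : Fin b → Bool,
      (if ∀ k, I k → k ∈ J then ∏ k, (if I k then x else 1) else (0 : ℝ))
        = ∏ k, (if I k then (if k ∈ J then x else 0) else 1) := by
    intro I
    split_ifs with h
    · refine Finset.prod_congr rfl fun k _ => ?_
      split_ifs with h1 h2
      · rfl
      · exact absurd (h k h1) h2
      · rfl
    · push Not at h
      obtain ⟨k, hk, hkJ⟩ := h
      exact (Finset.prod_eq_zero (Finset.mem_univ k) (by simp [hk, hkJ])).symm
  simp only [h1]
  have h2 := Finset.prod_univ_sum (fun _ : Fin b => (Finset.univ : Finset Bool))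
    (fun k i => if i then (if k ∈ J then x else 0) else 1)
  rw [Fintype.piFinset_univ] at h2
  rw [← h2]
  have h3 : ∀ k : Fin b, (∑ i : Bool, if i = true then (if k ∈ J then x else 0) else (1 : ℝ))
      = if k ∈ J then 1 + x else 1 := by
    intro k
    simp only [Fintype.sum_bool, if_true, Bool.false_eq_true, if_false]
    split_ifs <;> ring
  simp only [h3]
  rw [Finset.prod_ite_mem, Finset.univ_inter, Finset.prod_const]

variable [G.LocallyFinite]

/-- The walks of `b` blocks of length `m + r` in which many blocks are bad, weighted accordingly,
are outnumbered by the self-avoiding walks of `G`. -/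
theorem sum_weight_bad_le {Γ A : Subgroup (G ≃g G)} (hN : Normalizes Γ A)
    {S : Set V} {r : ℕ} (hS : Pattern A S r) {K : ℕ} (hK : 1 ≤ K) (m b : ℕ)
    {c z : ℝ} (hc : 0 ≤ c) (hcM : ∀ v, ((walks G v (m + r)).card : ℝ) * c ≤ 1)
    (hz : 0 ≤ z) (hz1 : z ≤ 1) (v : V) (W : Finset (List V))
    (hW : W ⊆ walks G v ((m + r) * b)) (hWt : ∀ l ∈ W, Transversal A l)
    (J : List V → Finset (Fin b))
    (hJ : ∀ l ∈ W, J l ⊆ badSet Γ S K m (m + r) b l)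
    (hfree : ∀ l ∈ W, Free Γ S (K + 1) l)
    (hdisj : ∀ l ∈ W, ∀ j ∈ J l, ∀ k ∈ J l, j ≠ k →
      Disjoint (translate S (badElt Γ S K m (blk (m + r) j l)))
        (translate S (badElt Γ S K m (blk (m + r) k l)))) :
    (∑ l ∈ W, (1 + c * z ^ r) ^ (J l).card) * z ^ ((m + r) * b)
      ≤ ∑ N ∈ Finset.range ((m + r) * b + r * b + 1),
          (cnt G (fun _ l => l.Nodup) v N : ℝ) * z ^ N := by
  set M := m + r with hM
  set Y : List V → Set V := fun B => translate S (badElt Γ S K m B) with hYdef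
  have hpat : ∀ B, Pattern A (Y B) r := fun B => hS.map hN (badElt_mem Γ S K m B)
  have hex : ∀ B, ∃ Ra : List V × (G ≃g G),
      Bad Γ S K m B → IsSurgery A (Y B) m r B Ra.1 Ra.2 := by
    intro B
    by_cases hB : Bad Γ S K m B
    · obtain ⟨R, a, h⟩ := (hpat B).exists_surgery m B (hB.exists_mem hK)
      exact ⟨(R, a), fun _ => h⟩
    · exact ⟨([], 1), fun h => absurd h hB⟩
  choose Ra hRa using hex
  set R : List V → List V := fun B => (Ra B).1
  set α : List V → G ≃g G := fun B => (Ra B).2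
  have hR : ∀ B, Bad Γ S K m B → IsSurgery A (Y B) m r B (R B) (α B) := hRa
  have hYinv : ∀ B, ∀ a ∈ A, ∀ w, a w ∈ Y B ↔ w ∈ Y B := fun B => (hpat B).inv
  set Ω : Finset (List V) := (Finset.range (M * b + r * b + 1)).biUnion fun N =>
    (walks G v N).filter fun l => l.Nodup with hΩ
  set wt : (Fin b → Bool) → ℝ := fun I => ∏ k, (if I k then c else 1) with hwt
  have hwt0 : ∀ I, 0 ≤ wt I := fun I =>
    Finset.prod_nonneg fun k _ => by split_ifs <;> linarith
  have hbad : ∀ l ∈ W, ∀ I : Fin b → Bool, (∀ k, I k → k ∈ J l) →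
      ∀ k : Fin b, I k → Bad Γ S K m (blk M k l) := fun l hl I hI k hk =>
    (Finset.mem_filter.1 (hJ l hl (hI k hk))).2
  have hlen : ∀ l ∈ W, ∀ I : Fin b → Bool, (∀ k, I k → k ∈ J l) →
      (rewrite M R α b l I).length ≤ M * b + r * (∑ k, if I k then 1 else 0) :=
    fun l hl I hI => rewrite_length hR b l I (hbad l hl I hI)
  have hsum : ∀ I : Fin b → Bool, (∑ k, if I k then 1 else 0) ≤ b := by
    intro I
    calc (∑ k, if I k then 1 else 0) ≤ ∑ _k : Fin b, 1 :=
          Finset.sum_le_sum fun k _ => by split_ifs <;> simp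
      _ = b := by simp
  have hmem : ∀ l ∈ W, ∀ I : Fin b → Bool, (∀ k, I k → k ∈ J l) →
      rewrite M R α b l I ∈ Ω := by
    intro l hl I hI
    have hlw := (mem_walks G).1 (hW hl)
    have h1 := rewrite_walk hR b v l I hlw.1 (hbad l hl I hI)
    have h2 := hlen l hl I hI
    have h3 := rewrite_nodup hR hYinv b l hlw.2 I (hbad l hl I hI) (hWt l hl)
      (fun j k hjk hk => Bad.notMem (hfree l hl) (fun h => hjk (Fin.ext h)) (hbad l hl I hI k hk))
      (fun j k hjk hj hk => hdisj l hl j (hI j hj) k (hI k hk) hjk)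
    rw [hΩ, Finset.mem_biUnion]
    refine ⟨_, ?_, Finset.mem_filter.2 ⟨(mem_walks G).2 ⟨h1, rfl⟩, h3⟩⟩
    rw [Finset.mem_range]
    have := Nat.mul_le_mul_left r (hsum I)
    omega
  have hstep : ∀ l ∈ W, (1 + c * z ^ r) ^ (J l).card * z ^ (M * b) ≤
      ∑ I : Fin b → Bool, ∑ ω ∈ Ω, if (∀ k, I k → k ∈ J l) ∧ rewrite M R α b l I = ω
        then z ^ ω.length * wt I else 0 := by
    intro l hl
    rw [← sum_bool_weight, Finset.sum_mul]
    refine Finset.sum_le_sum fun I _ => ?_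
    by_cases hI : ∀ k, I k → k ∈ J l
    · rw [if_pos hI]
      have hI' : (∀ k, I k → k ∈ J l) = True := eq_true hI
      simp only [hI', true_and]
      rw [Finset.sum_ite_eq, if_pos (hmem l hl I hI)]
      -- The factor `z ^ r` of a replaced block pays for the at most `r` extra steps of its
      -- replacement; as `z ≤ 1`, the upper bound on the length becomes a lower bound on the weight.
      have h1 : (∏ k, (if I k then c * z ^ r else 1))
          = wt I * z ^ (r * (∑ k, if I k then 1 else 0)) := by
        rw [hwt, Finset.mul_sum, ← Finset.prod_pow_eq_pow_sum, ← Finset.prod_mul_distrib]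
        refine Finset.prod_congr rfl fun k _ => ?_
        split_ifs <;> simp
      rw [h1, mul_assoc, ← pow_add, mul_comm]
      refine mul_le_mul_of_nonneg_right (pow_le_pow_of_le_one hz hz1 ?_) (hwt0 I)
      have := hlen l hl I hI
      omega
    · rw [if_neg hI, zero_mul]
      refine Finset.sum_nonneg fun ω _ => ?_
      split_ifs
      · exact mul_nonneg (pow_nonneg hz _) (hwt0 I)
      · exact le_rfl
  have hdecode : ∀ ω ∈ Ω, (∑ l ∈ W, ∑ I : Fin b → Bool,
      if (∀ k, I k → k ∈ J l) ∧ rewrite M R α b l I = ω then z ^ ω.length * wt I else 0)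
        ≤ z ^ ω.length := by
    intro ω _
    have h1 := sum_rewrite_le_one (A := A) hM hR hc hcM b v ω
    refine le_trans ?_ (mul_le_of_le_one_right (pow_nonneg hz ω.length) h1)
    rw [Finset.mul_sum]
    refine (Finset.sum_le_sum fun l hl => ?_).trans
      (Finset.sum_le_sum_of_subset_of_nonneg hW fun l _ _ => mul_nonneg (pow_nonneg hz _)
        (Finset.sum_nonneg fun I _ => ?_))
    · rw [Finset.mul_sum]
      refine Finset.sum_le_sum fun I _ => ?_
      by_cases h : (∀ k, I k → k ∈ J l) ∧ rewrite M R α b l I = ω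
      · rw [if_pos h, if_pos]
        exact ⟨fun k => ⟨(hWt l hl).sublist (blk_sublist _ _ _), hbad l hl I h.1 k⟩, h.2⟩
      · rw [if_neg h]
        split_ifs
        · exact mul_nonneg (pow_nonneg hz _) (hwt0 I)
        · simp
    · split_ifs
      · exact hwt0 I
      · exact le_rfl
  calc _ = ∑ l ∈ W, (1 + c * z ^ r) ^ (J l).card * z ^ (M * b) := Finset.sum_mul _ _ _
    _ ≤ ∑ l ∈ W, ∑ I : Fin b → Bool, ∑ ω ∈ Ω,
        if (∀ k, I k → k ∈ J l) ∧ rewrite M R α b l I = ω then z ^ ω.length * wt I else 0 :=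
      Finset.sum_le_sum hstep
    _ = ∑ ω ∈ Ω, ∑ l ∈ W, ∑ I : Fin b → Bool,
        if (∀ k, I k → k ∈ J l) ∧ rewrite M R α b l I = ω then z ^ ω.length * wt I else 0 := by
      rw [Finset.sum_comm]
      refine Eq.trans ?_ Finset.sum_comm
      rw [Finset.sum_comm]
      exact Finset.sum_congr rfl fun l _ => Finset.sum_comm
    _ ≤ ∑ ω ∈ Ω, z ^ ω.length := Finset.sum_le_sum hdecode
    _ = _ := by
      rw [hΩ, Finset.sum_biUnion]
      · refine Finset.sum_congr rfl fun N _ => ?_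
        rw [cnt, ← nsmul_eq_mul, ← Finset.sum_const]
        refine Finset.sum_congr (Finset.ext fun l => by simp only [Finset.mem_filter]) fun l hl => ?_
        have hl' : l ∈ walks G v N ∧ l.Nodup := by simpa using hl
        rw [((mem_walks G).1 hl'.1).2]
      · intro N _ N' _ hNN
        refine Finset.disjoint_left.2 fun l hl hl' => hNN ?_
        rw [← ((mem_walks G).1 (Finset.mem_filter.1 hl).1).2,
          ← ((mem_walks G).1 (Finset.mem_filter.1 hl').1).2]

end Blocks

/-! ### The induction on the number of visits -/

section Step

open scoped Classical
open Filter

/-- Take `b = k * n` and `b' = n`. A large fixed `k` makes the second term exponentially small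
relative to `μ ^ (M * b)`. With `k` fixed, `z = y / μ` for `y` close enough to `1` loses only `y ^
(M * k)` per unit of `n`, less than the gain `1 + c * z ^ r`. -/
theorem exists_lt_pow_of_le {μ θ s c : ℝ} {M D r : ℕ} (hμ : 1 ≤ μ) (hθ0 : 0 ≤ θ)
    (hθ : θ < μ ^ M) (hs : 0 < s) (hc : 0 < c) (E : ℕ → ℝ)
    (h : ∀ z : ℝ, 0 < z → z * μ < 1 → ∃ C : ℝ, ∀ b b' : ℕ,
      E b ≤ C / ((1 + c * z ^ r) ^ b' * z ^ (M * b)) + θ ^ b / s ^ (D * b')) :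
    ∃ b : ℕ, 1 ≤ b ∧ E b < μ ^ (M * b) := by
  have hμ0 : 0 < μ := by linarith
  set x := θ / μ ^ M with hx
  have hx0 : 0 ≤ x := by positivity
  have hx1 : x < 1 := (div_lt_one (by positivity)).2 hθ
  obtain ⟨k, hk1, hk⟩ : ∃ k : ℕ, 1 ≤ k ∧ x ^ k < s ^ D := by
    obtain ⟨k, hk⟩ := exists_pow_lt_of_lt_one (pow_pos hs D) hx1
    exact ⟨k + 1, by omega, (pow_le_pow_of_le_one hx0 hx1.le (Nat.le_succ k)).trans_lt hk⟩
  -- A lower bound for the gain, valid for every `y > 1 / 2`, so that `y` can be chosen afterwards.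
  set a := 1 + c * (1 / (2 * μ)) ^ r with ha
  have ha1 : 1 < a := by
    have : 0 < c * (1 / (2 * μ)) ^ r := by positivity
    linarith
  obtain ⟨y, hy2, hy1, hya⟩ : ∃ y : ℝ, 1 / 2 < y ∧ y < 1 ∧ 1 < y ^ (M * k) * a := by
    have hcont : Tendsto (fun y : ℝ => y ^ (M * k) * a) (nhdsWithin 1 (Set.Iio 1)) (nhds a) := by
      have : Continuous fun y : ℝ => y ^ (M * k) * a := by fun_prop
      have h1 := this.tendsto 1
      simp only [one_pow, one_mul] at h1
      exact h1.mono_left nhdsWithin_le_nhds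
    have h1 := hcont.eventually (lt_mem_nhds ha1)
    have h2 : ∀ᶠ y : ℝ in nhdsWithin 1 (Set.Iio 1), 1 / 2 < y :=
      nhdsWithin_le_nhds (lt_mem_nhds (by norm_num))
    have h3 : ∀ᶠ y : ℝ in nhdsWithin 1 (Set.Iio 1), y < 1 := self_mem_nhdsWithin
    obtain ⟨y, hy⟩ := (h1.and (h2.and h3)).exists
    exact ⟨y, hy.2.1, hy.2.2, hy.1⟩
  have hy0 : 0 < y := by linarith
  set z := y / μ with hz
  have hz0 : 0 < z := by positivity
  have hzμ : z * μ = y := by rw [hz]; field_simp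
  obtain ⟨C, hC⟩ := h z hz0 (by rw [hzμ]; exact hy1)
  have hza : a ≤ 1 + c * z ^ r := by
    have : 1 / (2 * μ) ≤ z := by
      rw [hz, div_le_div_iff₀ (by positivity) hμ0]
      nlinarith
    rw [ha]
    gcongr
  set a' := 1 + c * z ^ r
  have ha' : 0 < a' := by linarith
  have hy' : 1 < y ^ (M * k) * a' :=
    hya.trans_le (mul_le_mul_of_nonneg_left hza (by positivity))
  have hlim : Tendsto (fun n : ℕ => C * ((y ^ (M * k) * a')⁻¹) ^ n + (x ^ k / s ^ D) ^ n) atTop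
      (nhds (C * 0 + 0)) := by
    refine Tendsto.add (Tendsto.const_mul C ?_) ?_
    · exact tendsto_pow_atTop_nhds_zero_of_lt_one (by positivity) (inv_lt_one_of_one_lt₀ hy')
    · exact tendsto_pow_atTop_nhds_zero_of_lt_one (by positivity)
        ((div_lt_one (by positivity)).2 hk)
  rw [mul_zero, add_zero] at hlim
  obtain ⟨n, hn, hn1⟩ := ((hlim.eventually (gt_mem_nhds zero_lt_one)).and
    (eventually_ge_atTop 1)).exists
  refine ⟨k * n, Nat.mul_pos hk1 hn1, (hC (k * n) n).trans_lt ?_⟩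
  have hpos : 0 < μ ^ (M * (k * n)) := by positivity
  calc C / (a' ^ n * z ^ (M * (k * n))) + θ ^ (k * n) / s ^ (D * n)
      = (C * ((y ^ (M * k) * a')⁻¹) ^ n + (x ^ k / s ^ D) ^ n) * μ ^ (M * (k * n)) := by
        rw [add_mul]
        congr 1
        · rw [← hzμ]
          simp only [mul_pow, inv_pow, ← pow_mul, ← mul_assoc]
          field_simp
        · rw [hx]
          simp only [div_pow, ← pow_mul, ← mul_assoc]
          field_simp
    _ < 1 * μ ^ (M * (k * n)) := mul_lt_mul_of_pos_right hn hpos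
    _ = μ ^ (M * (k * n)) := one_mul _

variable {V : Type*} {G : SimpleGraph V} [G.LocallyFinite]

/-- The number of `n`-step walks from `v` that, apart from `v`, visit distinct orbits and are
`K`-free. -/
noncomputable def freeCount (Γ A : Subgroup (G ≃g G)) (S : Set V) (K : ℕ) (v : V) (n : ℕ) : ℕ :=
  cnt G (fun _ l => Transversal A l ∧ Free Γ S K l) v n

theorem cnt_eq_of_transitive {Γ : Subgroup (G ≃g G)} (hΓ : ∀ v w : V, ∃ γ ∈ Γ, γ v = w)
    (P : V → List V → Prop) (hP : ∀ γ ∈ Γ, ∀ v l, P (γ v) (l.map γ) ↔ P v l) (v w : V) (n : ℕ) :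
    cnt G P v n = cnt G P w n := by
  obtain ⟨γ, hγ, rfl⟩ := hΓ w v
  exact cnt_map G P γ (hP γ hγ) w n

theorem freeCount_mul_le {Γ A : Subgroup (G ≃g G)} (hN : Normalizes Γ A)
    (hΓ : ∀ v w : V, ∃ γ ∈ Γ, γ v = w) (S : Set V) (K : ℕ) (v : V) (n j : ℕ) :
    freeCount Γ A S K v (n * j) ≤ freeCount Γ A S K v n ^ j := by
  induction j with
  | zero =>
    rw [Nat.mul_zero, pow_zero]
    refine (cnt_mono G (Q := fun _ _ => True) v 0 fun _ _ _ => trivial).trans ?_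
    simp [cnt, walks]
  | succ j ih =>
    rw [Nat.mul_succ, pow_succ]
    refine le_trans (cnt_add_le G (Q := fun _ l => Transversal A l ∧ Free Γ S K l)
      (R := fun _ l => Transversal A l ∧ Free Γ S K l) (C := freeCount Γ A S K v n)
      (fun l l' _ _ h => ⟨⟨h.1.append.1, h.2.sublist (List.sublist_append_left _ _)⟩,
        h.1.append.2, h.2.sublist (List.sublist_append_right _ _)⟩)
      (fun w => (cnt_eq_of_transitive hΓ _ (fun γ hγ v l => by
        rw [hN.transversal_map hγ, free_map hγ]) w v n).le)) ?_
    exact Nat.mul_le_mul_right _ ih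

/-- By submultiplicativity, a strict inequality at one length becomes an exponential gap along its
multiples, which absorbs any constant. The factor `t` will count the transversal continuations over
the last `r` steps of a block. -/
theorem exists_freeCount_lt {Γ A : Subgroup (G ≃g G)} (hN : Normalizes Γ A)
    (hΓ : ∀ v w : V, ∃ γ ∈ Γ, γ v = w) {S : Set V} {K : ℕ} {v : V} {μ : ℝ} (hμ : 1 ≤ μ)
    (hE : ∃ n, 1 ≤ n ∧ (freeCount Γ A S K v n : ℝ) < μ ^ n) (t : ℝ) (ht : 0 ≤ t) (r : ℕ) :
    ∃ m, 1 ≤ m ∧ (freeCount Γ A S K v m : ℝ) * t < μ ^ (m + r) := by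
  obtain ⟨n, hn1, hn⟩ := hE
  have hμ0 : 0 < μ := by linarith
  set x := (freeCount Γ A S K v n : ℝ) / μ ^ n with hx
  have hx0 : 0 ≤ x := by positivity
  have hx1 : x < 1 := (div_lt_one (by positivity)).2 hn
  have hlim : Tendsto (fun j : ℕ => x ^ j * t) atTop (nhds (0 * t)) :=
    (tendsto_pow_atTop_nhds_zero_of_lt_one hx0 hx1).mul_const t
  rw [zero_mul] at hlim
  obtain ⟨j, hj, hj1⟩ := ((hlim.eventually (gt_mem_nhds (show 0 < μ ^ r by positivity))).and
    (eventually_ge_atTop 1)).exists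
  refine ⟨n * j, Nat.mul_pos hn1 hj1, ?_⟩
  calc (freeCount Γ A S K v (n * j) : ℝ) * t ≤ (freeCount Γ A S K v n : ℝ) ^ j * t :=
        mul_le_mul_of_nonneg_right (by exact_mod_cast freeCount_mul_le hN hΓ S K v n j) ht
    _ = x ^ j * t * μ ^ (n * j) := by
        rw [hx, div_pow, ← pow_mul]
        field_simp
    _ < μ ^ r * μ ^ (n * j) := mul_lt_mul_of_pos_right hj (by positivity)
    _ = μ ^ (n * j + r) := by rw [← pow_add, add_comm]

/-- A block that is not bad is `K`-free only in its first `m` steps; the last `r` steps are bounded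
merely by transversality. -/
theorem sum_block_weight_le {Γ A : Subgroup (G ≃g G)} (hN : Normalizes Γ A)
    (hΓ : ∀ v w : V, ∃ γ ∈ Γ, γ v = w) (S : Set V) (K m r : ℕ) (v : V) {s : ℝ} (hs : 0 ≤ s)
    (w : V) :
    ∑ B ∈ walks G w (m + r),
      (if Transversal A B then (if Bad Γ S K m B then s else 1) else 0)
      ≤ freeCount Γ A S K v m * cnt G (fun _ l => Transversal A l) v r
        + s * cnt G (fun _ l => Transversal A l) v (m + r) := by
  have hT : ∀ n u, cnt G (fun _ l => Transversal A l) u n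
      = cnt G (fun _ l => Transversal A l) v n := fun n u =>
    cnt_eq_of_transitive hΓ _ (fun γ hγ v l => hN.transversal_map hγ l) u v n
  have hF : freeCount Γ A S K w m = freeCount Γ A S K v m :=
    cnt_eq_of_transitive hΓ _ (fun γ hγ v l => by
        rw [hN.transversal_map hγ, free_map hγ]) w v m
  have h1 : cnt G (fun _ B => Transversal A B ∧ Free Γ S K (B.take m)) w (m + r)
      ≤ freeCount Γ A S K w m * cnt G (fun _ l => Transversal A l) v r := by
    refine cnt_add_le G (R := fun _ l => Transversal A l) ?_ fun u => (hT r u).le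
    rintro l l' rfl _ h
    rw [List.take_left'] at h
    · exact ⟨⟨h.1.append.1, h.2⟩, h.1.append.2⟩
    · rfl
  rw [← hF]
  refine le_trans ?_ (add_le_add (Nat.cast_le (α := ℝ).2 h1)
    (le_of_eq (congrArg (fun n : ℕ => s * (n : ℝ)) (hT (m + r) w)))) |>.trans (by push_cast; rfl)
  rw [cnt_eq_sum, cnt_eq_sum, Finset.mul_sum, ← Finset.sum_add_distrib]
  refine Finset.sum_le_sum fun B _ => ?_
  by_cases hB : Transversal A B
  · by_cases hb : Free Γ S K (B.take m)
    · simp [hB, hb, Bad, hs]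
    · simp [hB, hb, Bad]
  · simp [hB]

theorem exists_freeCount_succ_lt (hconn : G.Connected) {Γ A : Subgroup (G ≃g G)} (hAΓ : A ≤ Γ)
    (hN : Normalizes Γ A) (hΓ : ∀ v w : V, ∃ γ ∈ Γ, γ v = w) {S : Set V} {r : ℕ}
    (hS : Pattern A S r) {K : ℕ} (hK : 1 ≤ K) {v : V} {μ : ℝ} (hμ : 1 ≤ μ)
    (hsum : ∀ z : ℝ, 0 < z → z * μ < 1 → ∃ C : ℝ, ∀ n,
      ∑ N ∈ Finset.range n, (cnt G (fun _ l => l.Nodup) v N : ℝ) * z ^ N ≤ C)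
    (hE : ∃ n, 1 ≤ n ∧ (freeCount Γ A S K v n : ℝ) < μ ^ n) :
    ∃ n, 1 ≤ n ∧ (freeCount Γ A S (K + 1) v n : ℝ) < μ ^ n := by
  have hμ0 : 0 < μ := by linarith
  obtain ⟨D, hD⟩ := exists_meeting_bound hconn hAΓ hN hS
  obtain ⟨m, hm1, hm⟩ := exists_freeCount_lt hN hΓ hμ hE
    (cnt G (fun _ l => Transversal A l) v r : ℝ) (Nat.cast_nonneg _) r
  -- At `s = 0` only the contribution of the good blocks remains, which is below `μ ^ (m + r)` by
  -- the choice of `m`; a small positive `s` preserves this.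
  obtain ⟨s, hs0, hs1, hs⟩ : ∃ s : ℝ, 0 < s ∧ s ≤ 1 ∧
      (freeCount Γ A S K v m : ℝ) * cnt G (fun _ l => Transversal A l) v r
        + s * cnt G (fun _ l => Transversal A l) v (m + r) < μ ^ (m + r) := by
    have hcont : Tendsto (fun s : ℝ =>
        (freeCount Γ A S K v m : ℝ) * cnt G (fun _ l => Transversal A l) v r
        + s * cnt G (fun _ l => Transversal A l) v (m + r)) (nhdsWithin 0 (Set.Ioi 0))
        (nhds ((freeCount Γ A S K v m : ℝ) * cnt G (fun _ l => Transversal A l) v r)) := by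
      have h0 : Continuous (fun s : ℝ =>
        (freeCount Γ A S K v m : ℝ) * cnt G (fun _ l => Transversal A l) v r
        + s * cnt G (fun _ l => Transversal A l) v (m + r)) := by fun_prop
      have h1 := h0.tendsto 0
      simp only [zero_mul, add_zero] at h1
      exact h1.mono_left nhdsWithin_le_nhds
    have h2 : ∀ᶠ s : ℝ in nhdsWithin 0 (Set.Ioi 0), s ≤ 1 :=
      nhdsWithin_le_nhds ((gt_mem_nhds zero_lt_one).mono fun s hs => le_of_lt hs)
    have h3 : ∀ᶠ s : ℝ in nhdsWithin 0 (Set.Ioi 0), 0 < s := self_mem_nhdsWithin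
    obtain ⟨s, h⟩ := ((hcont.eventually (gt_mem_nhds hm)).and (h2.and h3)).exists
    exact ⟨s, h.2.2, h.2.1, h.1⟩
  set θ := (freeCount Γ A S K v m : ℝ) * cnt G (fun _ l => Transversal A l) v r
        + s * cnt G (fun _ l => Transversal A l) v (m + r) with hθdef
  have hθ0 : 0 ≤ θ := by positivity
  have hcard : ∀ w, (walks G w (m + r)).card = (walks G v (m + r)).card := by
    intro w
    have := cnt_eq_of_transitive hΓ (fun _ _ => True) (fun _ _ _ _ => Iff.rfl) w v (m + r)
    simpa [cnt] using this
  set c : ℝ := 1 / ((walks G v (m + r)).card + 1) with hc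
  have hc0 : 0 < c := by positivity
  have hcM : ∀ w, ((walks G w (m + r)).card : ℝ) * c ≤ 1 := by
    intro w
    rw [hcard, hc, mul_one_div, div_le_one (by positivity)]
    linarith
  suffices hmain : ∀ z : ℝ, 0 < z → z * μ < 1 → ∃ C : ℝ, ∀ b b' : ℕ,
      (freeCount Γ A S (K + 1) v ((m + r) * b) : ℝ)
        ≤ C / ((1 + c * z ^ r) ^ b' * z ^ ((m + r) * b)) + θ ^ b / s ^ (D * b') by
    obtain ⟨b, hb1, hb⟩ := exists_lt_pow_of_le hμ hθ0 hs hs0 hc0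
      (fun b => (freeCount Γ A S (K + 1) v ((m + r) * b) : ℝ)) hmain
    exact ⟨(m + r) * b, Nat.mul_pos (by omega) hb1, hb⟩
  intro z hz0 hzμ
  obtain ⟨C, hC⟩ := hsum z hz0 hzμ
  have hz1 : z ≤ 1 := by nlinarith
  refine ⟨C, fun b b' => ?_⟩
  set M := m + r with hM
  set W := (walks G v (M * b)).filter fun l => Transversal A l ∧ Free Γ S (K + 1) l with hW
  have hWprop : ∀ l ∈ W, l ∈ walks G v (M * b) ∧ Transversal A l ∧ Free Γ S (K + 1) l :=
    fun l hl => Finset.mem_filter.1 hl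
  have hex : ∀ l, ∃ J : Finset (Fin b), l ∈ W → J ⊆ badSet Γ S K m M b l ∧
      (∀ j ∈ J, ∀ k ∈ J, j ≠ k →
      Disjoint (translate S (badElt Γ S K m (blk M j l)))
        (translate S (badElt Γ S K m (blk M k l)))) ∧
      (badSet Γ S K m M b l).card ≤ D * J.card := by
    intro l
    by_cases hl : l ∈ W
    · obtain ⟨J, h⟩ := exists_disjoint_bad hK hD b l (hWprop l hl).2.2 (m := m) (M := M)
      exact ⟨J, fun _ => h⟩
    · exact ⟨∅, fun h => absurd h hl⟩
  choose J hJ using hex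
  have hup := sum_weight_bad_le hN hS hK m b hc0.le hcM hz0.le hz1 v W
    (Finset.filter_subset _ _) (fun l hl => (hWprop l hl).2.1) J (fun l hl => (hJ l hl).1)
    (fun l hl => (hWprop l hl).2.2) (fun l hl => (hJ l hl).2.1)
  have hdown : ∑ l ∈ W, s ^ (badSet Γ S K m M b l).card ≤ θ ^ b := by
    refine le_trans ?_ (sum_prod_blk_le M
      (fun B => if Transversal A B then (if Bad Γ S K m B then s else 1) else 0) ?_
      (sum_block_weight_le hN hΓ S K m r v hs0.le) b v)
    · refine le_trans (Finset.sum_le_sum fun l hl => ?_)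
        (Finset.sum_le_sum_of_subset_of_nonneg (Finset.filter_subset _ _) fun l _ _ => ?_)
      · refine le_of_eq ?_
        rw [badSet, ← Finset.prod_const, Finset.prod_filter]
        refine Finset.prod_congr rfl fun k _ => ?_
        rw [if_pos ((hWprop l hl).2.1.sublist (blk_sublist _ _ _))]
      · refine Finset.prod_nonneg fun k _ => ?_
        split_ifs <;> linarith
    · intro B
      split_ifs <;> linarith
  set a := 1 + c * z ^ r with ha
  have ha1 : 1 ≤ a := by
    have : 0 ≤ c * z ^ r := by positivity
    linarith
  -- Both kinds of walks are counted at once: with at least `b'` disjoint bad blocks the first term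
  -- is at least `1`, and otherwise there are at most `D * b'` bad blocks and the second term is.
  have hone : ∀ l ∈ W, (1 : ℝ) ≤ a ^ (J l).card / a ^ b'
      + s ^ (badSet Γ S K m M b l).card / s ^ (D * b') := by
    intro l hl
    rcases le_total b' (J l).card with h | h
    · have h1 : 1 ≤ a ^ (J l).card / a ^ b' := by
        rw [one_le_div (by positivity)]
        exact pow_le_pow_right₀ ha1 h
      have h2 : 0 ≤ s ^ (badSet Γ S K m M b l).card / s ^ (D * b') := by positivity
      linarith
    · have h1 : 1 ≤ s ^ (badSet Γ S K m M b l).card / s ^ (D * b') := by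
        rw [one_le_div (by positivity)]
        exact pow_le_pow_of_le_one hs0.le hs1
          ((hJ l hl).2.2.trans (Nat.mul_le_mul_left D h))
      have h2 : 0 ≤ a ^ (J l).card / a ^ b' := by positivity
      linarith
  calc (freeCount Γ A S (K + 1) v (M * b) : ℝ) = ∑ l ∈ W, 1 := by
        rw [Finset.sum_const, nsmul_eq_mul, mul_one, hW, freeCount, cnt]
        congr!
    _ ≤ ∑ l ∈ W, (a ^ (J l).card / a ^ b' + s ^ (badSet Γ S K m M b l).card / s ^ (D * b')) :=
        Finset.sum_le_sum hone
    _ = (∑ l ∈ W, a ^ (J l).card) / a ^ b'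
        + (∑ l ∈ W, s ^ (badSet Γ S K m M b l).card) / s ^ (D * b') := by
        rw [Finset.sum_add_distrib, Finset.sum_div, Finset.sum_div]
    _ ≤ C / (a ^ b' * z ^ (M * b)) + θ ^ b / s ^ (D * b') := by
        refine add_le_add ?_ (div_le_div_of_nonneg_right hdown (by positivity))
        rw [mul_comm, ← div_div]
        refine div_le_div_of_nonneg_right ?_ (by positivity)
        rw [le_div_iff₀ (by positivity)]
        exact hup.trans (hC _)

/-- The number of transversal walks grows strictly slower than `μ ^ n`. -/
theorem exists_transversal_lt (hconn : G.Connected) {Γ A : Subgroup (G ≃g G)} (hAΓ : A ≤ Γ)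
    (hN : Normalizes Γ A) (hΓ : ∀ v w : V, ∃ γ ∈ Γ, γ v = w) {S : Set V} {r : ℕ}
    (hS : Pattern A S r) {v : V} {μ : ℝ} (hμ : 1 ≤ μ)
    (hsum : ∀ z : ℝ, 0 < z → z * μ < 1 → ∃ C : ℝ, ∀ n,
      ∑ N ∈ Finset.range n, (cnt G (fun _ l => l.Nodup) v N : ℝ) * z ^ N ≤ C) :
    ∃ n, 1 ≤ n ∧ (cnt G (fun v l => Transversal A (v :: l)) v n : ℝ) < μ ^ n := by
  have hall : ∀ K, 1 ≤ K → ∃ n, 1 ≤ n ∧ (freeCount Γ A S K v n : ℝ) < μ ^ n := by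
    intro K hK
    induction K, hK using Nat.le_induction with
    | base =>
      refine ⟨1, le_rfl, ?_⟩
      -- By transitivity every vertex lies in some translate of `S`, so even one step is a visit.
      have h0 : freeCount Γ A S 1 v 1 = 0 := by
        refine (cnt_eq_zero_iff G).2 ?_
        rintro l hl ⟨-, hf⟩
        obtain ⟨u, rfl⟩ := List.length_eq_one_iff.1 ((mem_walks G).1 hl).2
        obtain ⟨w, hw⟩ := hS.nonempty
        obtain ⟨γ, hγ, rfl⟩ := hΓ w u
        have := hf γ hγ
        rw [Nat.lt_one_iff, visits, List.countP_eq_zero] at this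
        exact this (γ w) (by simp) (by simpa using apply_mem_translate.2 hw)
      rw [h0]
      simpa using lt_of_lt_of_le zero_lt_one hμ
    | succ K hK ih => exact exists_freeCount_succ_lt hconn hAΓ hN hΓ hS hK hμ hsum ih
  obtain ⟨n, hn1, hn⟩ := hall (hS.finite.toFinset.card + 1) (by omega)
  refine ⟨n, hn1, lt_of_le_of_lt (Nat.cast_le.2 (cnt_mono G v n fun l _ hl => ?_)) hn⟩
  have hl' : Transversal A l := hl.sublist (List.sublist_cons_self v l)
  exact ⟨hl', hS.free_of_transversal hN hl'⟩

end Step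

/-! ### Patterns from the hypotheses on orbits -/

section Patterns

variable {V : Type*} {G : SimpleGraph V} {A : Subgroup (G ≃g G)}

theorem orb_eq_of_mem_orbit {v w : V} (h : w ∈ MulAction.orbit A v) : orb A w = orb A v := by
  obtain ⟨a, rfl⟩ := h
  exact orb_apply a.2 v

theorem orbit_eq_iff_orb_eq {v w : V} :
    MulAction.orbit A v = MulAction.orbit A w ↔ orb A v = orb A w := by
  rw [MulAction.orbit_eq_iff]
  constructor
  · exact orb_eq_of_mem_orbit
  · intro h
    obtain ⟨a, ha, rfl⟩ := orb_eq_iff.1 h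
    exact ⟨⟨a, ha⟩, rfl⟩

theorem isWalkFrom_seq (f : ℕ → V) (hf : ∀ k, G.Adj (f k) (f (k + 1))) (i s : ℕ) :
    IsWalkFrom G (f i) ((List.range s).map fun t => f (i + 1 + t)) ∧
      endpt (f i) ((List.range s).map fun t => f (i + 1 + t)) = f (i + s) := by
  induction s with
  | zero => simp
  | succ s ih =>
    rw [List.range_succ, List.map_append, isWalkFrom_append, endpt_append, ih.2]
    refine ⟨⟨ih.1, ?_, trivial⟩, ?_⟩
    · have := hf (i + s)
      rwa [show i + s + 1 = i + 1 + s by ring] at this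
    · simp only [List.map_cons, List.map_nil, endpt_cons, endpt_nil]
      congr 1
      ring

/-- The orbits met by an infinite walk form a pattern, if the walk returns to an orbit exactly after
each period of `l` steps, and then at a different vertex. -/
theorem pattern_of_periodic {l : ℕ} (hl : 1 ≤ l) (w : ℕ → V) (hadj : ∀ k, G.Adj (w k) (w (k + 1)))
    (horb : ∀ j k, orb A (w j) = orb A (w k) ↔ j ≡ k [MOD l]) (hne : ∀ k, w k ≠ w (k + l)) :
    Pattern A {x | ∃ k, orb A x = orb A (w k)} (2 * l) where
  inv a ha x := by simp [orb_apply ha]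
  nonempty := ⟨w 0, 0, rfl⟩
  finite := by
    refine ((Finset.range l).finite_toSet.image fun k => orb A (w k)).subset ?_
    rintro _ ⟨x, ⟨k, hk⟩, rfl⟩
    refine ⟨k % l, ?_, ?_⟩
    · simpa using Nat.mod_lt k hl
    · rw [hk]
      exact (horb _ _).2 (Nat.mod_modEq k l)
  detour := by
    rintro x ⟨i', hi'⟩ y ⟨j', hj'⟩
    obtain ⟨i, hil, hi⟩ : ∃ i < l, orb A x = orb A (w i) :=
      ⟨i' % l, Nat.mod_lt _ hl, hi'.trans ((horb _ _).2 (Nat.mod_modEq i' l).symm)⟩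
    obtain ⟨j, hjl, hj⟩ : ∃ j < l, orb A y = orb A (w j) :=
      ⟨j' % l, Nat.mod_lt _ hl, hj'.trans ((horb _ _).2 (Nat.mod_modEq j' l).symm)⟩
    -- At least `l` steps force an orbit to repeat; with fewer than `2 * l`, repetitions occur only
    -- at distance exactly `l`, where `hne` keeps the vertices distinct.
    obtain ⟨s, hls, hsl, hs⟩ : ∃ s, l ≤ s ∧ s < 2 * l ∧ i + s ≡ j [MOD l] := by
      rcases le_total i j with h | h
      · refine ⟨j - i + l, by omega, by omega, ?_⟩
        rw [show i + (j - i + l) = j + l by omega]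
        simp [Nat.ModEq]
      · rcases h.eq_or_lt with rfl | h
        · exact ⟨l, le_rfl, by omega, by simp [Nat.ModEq]⟩
        · refine ⟨j + 2 * l - i, by omega, by omega, ?_⟩
          rw [show i + (j + 2 * l - i) = j + l * 2 by omega]
          simp [Nat.ModEq]
    obtain ⟨a, ha, rfl⟩ := orb_eq_iff.1 hi
    set f : ℕ → V := fun k => a (w k) with hf
    have hfadj : ∀ k, G.Adj (f k) (f (k + 1)) := fun k => a.map_adj_iff.2 (hadj k)
    have hforb : ∀ k, orb A (f k) = orb A (w k) := fun k => orb_apply ha _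
    have hd : f i :: (List.range s).map (fun t => f (i + 1 + t))
        = (List.range (s + 1)).map fun t => f (i + t) := by
      rw [List.range_succ_eq_map, List.map_cons, List.map_map, add_zero]
      congr 1
      refine List.map_congr_left fun t _ => ?_
      simp only [Function.comp]
      congr 1
      omega
    have hend : orb A (f (i + s)) = orb A y := by
      rw [hforb, hj]
      exact (horb _ _).2 hs
    obtain ⟨b, hb, hby⟩ := orb_eq_iff.1 hend
    have hinj : ∀ t ≤ s, ∀ t' ≤ s, t < t' → f (i + t) ≠ f (i + t') := by
      intro t _ t' ht' htt h
      have h1 : i + t ≡ i + t' [MOD l] := by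
        rw [← horb, ← hforb, ← hforb, h]
      have h2 : t ≡ t' [MOD l] := Nat.ModEq.add_left_cancel' i h1
      obtain ⟨q, hq⟩ := (Nat.modEq_iff_dvd' htt.le).1 h2
      have hq1 : q = 1 := by
        rcases Nat.lt_trichotomy q 1 with h | h | h
        · have : q = 0 := by omega
          subst this
          omega
        · exact h
        · have : l * 2 ≤ l * q := Nat.mul_le_mul_left l h
          omega
      subst hq1
      have h3 : i + t' = i + t + l := by omega
      rw [h3] at h
      exact hne _ (a.injective h)
    refine ⟨(List.range s).map fun t => f (i + 1 + t), b, hb, (isWalkFrom_seq f hfadj i s).1,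
      (isWalkFrom_seq f hfadj i s).2.trans hby.symm, ?_, ?_, ?_, by simpa using hsl⟩
    · change (f i :: _).Nodup
      rw [hd]
      refine List.Nodup.map_on ?_ List.nodup_range
      intro t ht t' ht' h
      rw [List.mem_range, Nat.lt_succ_iff] at ht ht'
      rcases Nat.lt_trichotomy t t' with h' | h' | h'
      · exact absurd h (hinj t ht t' ht' h')
      · exact h'
      · exact absurd h.symm (hinj t' ht' t ht h')
    · intro u hu
      obtain ⟨t, -, rfl⟩ := List.mem_map.1 hu
      exact ⟨_, hforb _⟩
    · change ¬ Transversal A (f i :: _)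
      rw [hd, Transversal, List.map_map]
      intro h
      have := List.inj_on_of_nodup_map h (x := 0) (by simp) (y := l) (by simp; omega) (by
        simp only [Function.comp, hforb, horb]
        simp [Nat.ModEq])
      omega

/-- Concatenating the walk with its images under the powers of `α` gives an infinite walk whose
orbits have period `l`. As `α` fixes no `w_i`, vertices one period apart differ. -/
theorem CondII.exists_pattern (h : CondII A) : ∃ S r, Pattern A S r := by
  obtain ⟨v, v', p, hp, -, hdist, α, hα, hαv, hfix⟩ := h
  have hl : 1 ≤ p.length := by
    rcases Nat.eq_zero_or_pos p.length with h0 | h0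
    · have h1 := hfix 0 (Nat.zero_le _)
      have h2 := p.getVert_length
      rw [h0] at h2
      rw [h2] at h1
      rw [p.getVert_zero] at h2
      subst h2
      exact absurd hαv.symm h1
    · exact h0
  set l := p.length with hldef
  have hpow : ∀ q : ℕ, α ^ q ∈ A := fun q => A.pow_mem hα q
  have horbw : ∀ k, orb A ((α ^ (k / l)) (p.getVert (k % l))) = orb A (p.getVert (k % l)) :=
    fun k => orb_apply (hpow _) _
  refine ⟨_, _, pattern_of_periodic (A := A) hl
    (fun k => (α ^ (k / l)) (p.getVert (k % l))) ?_ ?_ ?_⟩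
  · intro k
    have hmod := Nat.mod_lt k hl
    rcases Nat.lt_or_ge (k % l + 1) l with h | h
    · have h1 : (k + 1) % l = k % l + 1 := by
        rw [Nat.add_mod, Nat.mod_eq_of_lt (show 1 < l by omega), Nat.mod_eq_of_lt h]
      have h2 : (k + 1) / l = k / l := by
        have e1 := Nat.div_add_mod k l
        have e2 := Nat.div_add_mod (k + 1) l
        rw [h1] at e2
        exact Nat.eq_of_mul_eq_mul_left hl (by omega)
      simp only [h1, h2]
      exact (α ^ (k / l)).map_adj_iff.2 (p.adj_getVert_succ (by omega))
    · have hk : k % l = l - 1 := by omega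
      have e1 := Nat.div_add_mod k l
      have hk1 : k + 1 = l * (k / l + 1) := by
        rw [Nat.mul_succ]
        omega
      have h1 : (k + 1) % l = 0 := by rw [hk1]; simp
      have h2 : (k + 1) / l = k / l + 1 := by
        rw [hk1]
        exact Nat.mul_div_cancel_left _ hl
      simp only [h1, h2, hk, pow_succ]
      change G.Adj _ ((α ^ (k / l)) (α (p.getVert 0)))
      have h3 := p.adj_getVert_succ (i := l - 1) (by omega)
      rw [show l - 1 + 1 = p.length by omega, p.getVert_length] at h3
      replace h3 : G.Adj (p.getVert (l - 1)) (α v) := by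
        generalize p.getVert (l - 1) = u at h3
        rwa [hαv] at h3
      rw [p.getVert_zero]
      exact (α ^ (k / l)).map_adj_iff.2 h3
  · intro j k
    rw [horbw, horbw, ← orbit_eq_iff_orb_eq, Nat.ModEq]
    constructor
    · intro h
      rcases Nat.lt_trichotomy (j % l) (k % l) with h' | h' | h'
      · exact absurd h (hdist _ _ h' (Nat.mod_lt _ hl))
      · exact h'
      · exact absurd h.symm (hdist _ _ h' (Nat.mod_lt _ hl))
    · intro h
      rw [h]
  · intro k h
    simp only [Nat.add_mod_right, Nat.add_div_right k hl, pow_succ] at h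
    exact hfix (k % l) (Nat.mod_lt _ hl).le ((α ^ (k / l)).injective h).symm

/-- Two available neighbours in the opposite orbit mean that one can alternate between the orbits
without stepping straight back; two or three steps suffice, according to the target orbit. -/
theorem exists_detour_of_two_orbits {o₁ o₂ : MulAction.orbitRel.Quotient A V}
    (h₁ : ∀ x, orb A x = o₁ → ∀ z, ∃ q ≠ z, G.Adj x q ∧ orb A q = o₂)
    (h₂ : ∀ x, orb A x = o₂ → ∀ z, ∃ q ≠ z, G.Adj x q ∧ orb A q = o₁) (ho : o₁ ≠ o₂)
    {x y : V} (hx : orb A x = o₁) (hy : orb A y = o₁ ∨ orb A y = o₂) :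
    ∃ d : List V, ∃ a ∈ A, IsWalkFrom G x d ∧ endpt x d = a y ∧
      (x :: d).Nodup ∧ (∀ w ∈ d, orb A w = o₁ ∨ orb A w = o₂) ∧
      ¬ Transversal A (x :: d) ∧ d.length < 4 := by
  obtain ⟨q, -, hxq, hq⟩ := h₁ x hx x
  obtain ⟨u, hux, hqu, hu⟩ := h₂ q hq x
  have hne : ∀ {z z' : V}, orb A z = o₁ → orb A z' = o₂ → z ≠ z' := by
    rintro z _ hz hz' rfl
    exact ho (hz.symm.trans hz')
  rcases hy with hy | hy
  · obtain ⟨a, ha, hay⟩ := orb_eq_iff.1 (hu.trans hy.symm)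
    refine ⟨[q, u], a, ha, ⟨hxq, hqu, trivial⟩, hay.symm, ?_, ?_, ?_, by simp⟩
    · simp [hne hx hq, hux.symm, (hne hu hq).symm]
    · simp [hq, hu]
    · simp [Transversal, hx, hu]
  · obtain ⟨q', hq'q, huq', hq'⟩ := h₁ u hu q
    obtain ⟨a, ha, hay⟩ := orb_eq_iff.1 (hq'.trans hy.symm)
    refine ⟨[q, u, q'], a, ha, ⟨hxq, hqu, huq', trivial⟩, hay.symm, ?_, ?_, ?_, by simp⟩
    · simp [hne hx hq, hux.symm, (hne hu hq).symm, hne hx hq', hq'q.symm, hne hu hq']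
    · simp [hq, hu, hq']
    · simp [Transversal, hx, hu]

/-- The pattern consists of the orbits of `v` and `w₁`, distinct because `L > 1`. Vertices in the
first orbit have two neighbours in the second by hypothesis, and conversely because `w₁` is adjacent
to both `v` and `v'`. -/
theorem CondI.exists_pattern (h : CondI A) (hL : orbitLength A = 2) : ∃ S r, Pattern A S r := by
  obtain ⟨v, v', p, hp, hlen, hv', hcount⟩ := h
  set q := p.getVert 1 with hq
  have hvq : G.Adj v q := by
    have := p.adj_getVert_succ (i := 0) (by omega)
    rwa [p.getVert_zero] at this
  have hqv' : G.Adj q v' := by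
    have := p.adj_getVert_succ (i := 1) (by omega)
    rwa [show 1 + 1 = p.length by omega, p.getVert_length] at this
  have hvv' : v ≠ v' := by
    rintro rfl
    have := SimpleGraph.Walk.length_eq_zero_iff.2 (SimpleGraph.Walk.isPath_iff_nil.1 hp)
    omega
  have ho : orb A v ≠ orb A q := by
    intro h
    have h1 : orbitLength A ≤ 1 := by
      refine Nat.sInf_le ⟨v, q, SimpleGraph.Walk.cons hvq SimpleGraph.Walk.nil, ?_, hvq.ne, ?_, rfl⟩
      · simp [hvq.ne]
      · rw [← MulAction.orbit_eq_iff]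
        exact orbit_eq_iff_orb_eq.2 h.symm
    omega
  have h₁ : ∀ x, orb A x = orb A v → ∀ z, ∃ u ≠ z, G.Adj x u ∧ orb A u = orb A q := by
    intro x hx z
    obtain ⟨a, ha, rfl⟩ := orb_eq_iff.1 hx
    obtain ⟨u, ⟨hu1, hu2⟩, huz⟩ := Set.exists_ne_of_one_lt_ncard hcount (a⁻¹ z)
    refine ⟨a u, ?_, a.map_adj_iff.2 hu1, ?_⟩
    · rintro rfl
      exact huz (by simp)
    · rw [orb_apply ha]
      exact orb_eq_of_mem_orbit hu2
  have h₂ : ∀ x, orb A x = orb A q → ∀ z, ∃ u ≠ z, G.Adj x u ∧ orb A u = orb A v := by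
    intro x hx z
    obtain ⟨a, ha, rfl⟩ := orb_eq_iff.1 hx
    by_cases hz : a v = z
    · refine ⟨a v', ?_, a.map_adj_iff.2 hqv', ?_⟩
      · rw [← hz]
        exact fun h => hvv' (a.injective h).symm
      · rw [orb_apply ha]
        exact orb_eq_of_mem_orbit hv'
    · exact ⟨a v, hz, a.map_adj_iff.2 hvq.symm, orb_apply ha _⟩
  refine ⟨{x | orb A x = orb A v ∨ orb A x = orb A q}, 4, ?_, ⟨v, Or.inl rfl⟩, ?_, ?_⟩
  · intro a ha w
    simp [orb_apply ha]
  · refine (Set.toFinite {orb A v, orb A q}).subset ?_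
    rintro _ ⟨x, hx, rfl⟩
    exact hx
  · rintro x (hx | hx) y hy
    · exact exists_detour_of_two_orbits h₁ h₂ ho hx hy
    · obtain ⟨d, a, ha, h1, h2, h3, h4, h5⟩ :=
        exists_detour_of_two_orbits h₂ h₁ ho.symm hx (Or.symm hy)
      exact ⟨d, a, ha, h1, h2, h3, fun w hw => (h4 w hw).symm, h5⟩

/-- If `L ≠ 2`, then the second condition holds for a shortest self-avoiding walk between distinct
vertices of the same orbit. -/
theorem condII_of_orbitLength_ne_two (hconn : G.Connected) (hA : A ≠ ⊥)
    (hL : orbitLength A ≠ 2) : CondII A := by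
  have hne : {n : ℕ | ∃ (v w : V) (p : G.Walk v w),
      p.IsPath ∧ v ≠ w ∧ w ∈ MulAction.orbit A v ∧ p.length = n}.Nonempty := by
    obtain ⟨a, ha1⟩ := Subgroup.ne_bot_iff_exists_ne_one.1 hA
    obtain ⟨v, hv⟩ : ∃ v, (a : G ≃g G) v ≠ v := by
      by_contra hcon
      push Not at hcon
      exact ha1 (Subtype.ext (RelIso.ext hcon))
    obtain ⟨p, hp⟩ := hconn.exists_isPath v ((a : G ≃g G) v)
    exact ⟨_, v, _, p, hp, hv.symm, ⟨a, rfl⟩, rfl⟩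
  obtain ⟨v, v', p, hp, hvv', hv', hlen⟩ := Nat.sInf_mem hne
  change p.length = orbitLength A at hlen
  have hmin : ∀ {u u' : V} (p' : G.Walk u u'), p'.IsPath → u ≠ u' → orb A u' = orb A u →
      p.length ≤ p'.length := by
    intro u u' p' hp' huu' horb
    rw [hlen]
    refine Nat.sInf_le ⟨u, u', p', hp', huu', ?_, rfl⟩
    rw [← MulAction.orbit_eq_iff]
    exact orbit_eq_iff_orb_eq.2 horb
  obtain ⟨⟨α, hα⟩, hαv⟩ := hv'
  change α v = v' at hαv
  refine ⟨v, v', p, hp, ⟨⟨α, hα⟩, hαv⟩, ?_, α, hα, hαv.symm, ?_⟩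
  · intro i j hij hj horb
    have h1 := hmin ((p.drop i).take (j - i)) ((hp.drop i).take (j - i)) ?_ ?_
    · rw [SimpleGraph.Walk.take_length] at h1
      omega
    · rw [SimpleGraph.Walk.drop_getVert, show i + (j - i) = j by omega]
      intro h
      have := hp.getVert_injOn (by simp; omega) (by simp; omega) h
      omega
    · rw [SimpleGraph.Walk.drop_getVert, show i + (j - i) = j by omega]
      exact (orbit_eq_iff_orb_eq.1 horb).symm
  · intro i hi hfix
    have hl0 : p.length ≠ 0 := fun h0 => hvv' (SimpleGraph.Walk.eq_of_length_eq_zero h0)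
    rcases Nat.lt_or_ge p.length 3 with h3 | h3
    · have hl1 : p.length = 1 := by omega
      have hαv' : α v' ≠ v' := by
        intro h
        rw [← hαv] at h
        exact hvv' ((α.injective h).symm.trans hαv)
      rcases Nat.eq_zero_or_pos i with rfl | hi0
      · rw [p.getVert_zero] at hfix
        exact hvv' (hfix.symm.trans hαv)
      · rw [show i = p.length by omega, p.getVert_length] at hfix
        exact hαv' hfix
    -- If `α` fixed `u` but moved its neighbour `u'`, then `u', u, α u'` would be a walk of length
    -- `2` joining distinct vertices of one orbit, contradicting `L ≥ 3`. By connectedness a single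
    -- fixed vertex would make `α` trivial.
    · have hstep : ∀ u u' : V, G.Adj u u' → α u = u → α u' = u' := by
        intro u u' hadj hu
        by_contra hne
        have hadj' : G.Adj u (α u') := by
          have := α.map_adj_iff.2 hadj
          rwa [hu] at this
        have := hmin (SimpleGraph.Walk.cons hadj.symm
          (SimpleGraph.Walk.cons hadj' SimpleGraph.Walk.nil)) ?_ (Ne.symm hne) (orb_apply hα _)
        · simp at this
          omega
        · simp [hadj.ne', hadj'.ne, Ne.symm hne]
      have hall : ∀ u, α u = u := by
        intro u
        generalize p.getVert i = u₀ at hfix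
        obtain ⟨r⟩ := hconn.preconnected u₀ u
        induction r with
        | nil => exact hfix
        | cons h r ih => exact ih (hstep _ _ h hfix)
      exact hvv' ((hall v).symm.trans hαv)

end Patterns

/-! ### Growth rates of submultiplicative sequences -/

section Growth

open Filter

/-- Fekete's lemma for submultiplicative sequences of natural numbers. -/
theorem exists_growth_rate (a : ℕ → ℕ) (ha : ∀ m n, a (m + n) ≤ a m * a n) :
    ∃ L : ℝ, 0 ≤ L ∧ Tendsto (fun n : ℕ => (a n : ℝ) ^ ((1 : ℝ) / (n : ℝ))) atTop (nhds L) ∧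
      ∀ n, 1 ≤ n → L ^ n ≤ a n := by
  by_cases h0 : ∃ n, a n = 0
  · obtain ⟨n₀, hn₀⟩ := h0
    refine ⟨0, le_rfl, ?_, fun n hn => ?_⟩
    · refine tendsto_const_nhds.congr' ?_
      filter_upwards [eventually_ge_atTop (n₀ + 1)] with n hn
      have h1 : a n = 0 := by
        have := ha n₀ (n - n₀)
        rw [hn₀, zero_mul, Nat.add_sub_cancel' (by omega)] at this
        omega
      have h2 : (n : ℝ) ≠ 0 := by
        have : n ≠ 0 := by omega
        exact_mod_cast this
      rw [h1, Nat.cast_zero, Real.zero_rpow (by positivity)]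
    · rw [zero_pow (by omega)]
      positivity
  · push Not at h0
    have hpos : ∀ n, (0 : ℝ) < a n := fun n => by exact_mod_cast Nat.pos_of_ne_zero (h0 n)
    have hone : ∀ n, (1 : ℝ) ≤ a n := fun n => by exact_mod_cast Nat.pos_of_ne_zero (h0 n)
    have hsub : Subadditive fun n => Real.log (a n) := by
      intro m n
      rw [← Real.log_mul (hpos m).ne' (hpos n).ne']
      exact Real.log_le_log (hpos _) (by exact_mod_cast ha m n)
    have hbdd : BddBelow (Set.range fun n : ℕ => Real.log (a n) / n) := by
      refine ⟨0, ?_⟩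
      rintro _ ⟨n, rfl⟩
      exact div_nonneg (Real.log_nonneg (hone n)) (Nat.cast_nonneg n)
    refine ⟨Real.exp hsub.lim, (Real.exp_pos _).le, ?_, fun n hn => ?_⟩
    · refine ((Real.continuous_exp.tendsto _).comp (hsub.tendsto_lim hbdd)).congr fun n => ?_
      rw [Real.rpow_def_of_pos (hpos n), Function.comp, mul_one_div]
    · have h1 := hsub.lim_le_div hbdd (n := n) (by omega)
      have h2 : (0 : ℝ) < n := by exact_mod_cast hn
      rw [le_div_iff₀ h2] at h1
      rw [← Real.exp_nat_mul, ← Real.exp_log (hpos n)]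
      exact Real.exp_le_exp.2 (by linarith)

theorem eventually_le_pow {a : ℕ → ℕ} {L ρ : ℝ}
    (ha : Tendsto (fun n : ℕ => (a n : ℝ) ^ ((1 : ℝ) / (n : ℝ))) atTop (nhds L)) (hρ : L < ρ) :
    ∀ᶠ n in atTop, (a n : ℝ) ≤ ρ ^ n := by
  filter_upwards [ha.eventually (gt_mem_nhds hρ), eventually_ge_atTop 1] with n hn hn1
  calc (a n : ℝ) = ((a n : ℝ) ^ ((1 : ℝ) / (n : ℝ))) ^ n := by
        rw [one_div, Real.rpow_inv_natCast_pow (Nat.cast_nonneg _) (by omega)]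
    _ ≤ ρ ^ n := pow_le_pow_left₀ (by positivity) hn.le n

end Growth

/-! ### Self-avoiding walks of the graph -/

section SawCount

open scoped Classical
open Filter

variable {V : Type*} {G : SimpleGraph V}

theorem isWalkFrom_support_tail {v w : V} (p : G.Walk v w) : IsWalkFrom G v p.support.tail := by
  induction p with
  | nil => simp
  | cons h p ih =>
    rw [SimpleGraph.Walk.support_cons, List.tail_cons, ← p.cons_tail_support]
    exact ⟨h, ih⟩

theorem endpt_support_tail {v w : V} (p : G.Walk v w) : endpt v p.support.tail = w := by
  induction p with
  | nil => simp
  | cons h p ih =>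
    rw [SimpleGraph.Walk.support_cons, List.tail_cons, ← p.cons_tail_support]
    exact ih

theorem exists_walk_of_isWalkFrom {v : V} {l : List V} (h : IsWalkFrom G v l) :
    ∃ (w : V) (p : G.Walk v w), p.support = v :: l := by
  induction l generalizing v with
  | nil => exact ⟨v, SimpleGraph.Walk.nil, rfl⟩
  | cons a l ih =>
    obtain ⟨w, p, hp⟩ := ih h.2
    exact ⟨w, SimpleGraph.Walk.cons h.1 p, by rw [SimpleGraph.Walk.support_cons, hp]⟩

theorem sawCount_eq_cnt [G.LocallyFinite] (v : V) (n : ℕ) :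
    sawCount G v n = cnt G (fun v l => (v :: l).Nodup) v n := by
  have hmem : ∀ l, l ∈ (walks G v n).filter (fun l => (v :: l).Nodup) ↔
      (IsWalkFrom G v l ∧ l.length = n) ∧ (v :: l).Nodup := fun l => by
    rw [Finset.mem_filter, mem_walks]
  have hcnt : cnt G (fun v l => (v :: l).Nodup) v n
      = Nat.card {l // l ∈ (walks G v n).filter (fun l => (v :: l).Nodup)} := by
    rw [Nat.card_eq_fintype_card, Fintype.card_coe, cnt]
    congr!
  rw [hcnt, sawCount]
  refine Nat.card_congr (Equiv.ofBijective
    (fun p => ⟨p.1.2.support.tail, (hmem _).2 ⟨⟨isWalkFrom_support_tail _, ?_⟩, ?_⟩⟩) ⟨?_, ?_⟩)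
  · rw [List.length_tail, SimpleGraph.Walk.length_support, p.2.2, Nat.add_sub_cancel]
  · rw [p.1.2.cons_tail_support]
    exact p.2.1.support_nodup
  · rintro ⟨⟨w, p⟩, hp⟩ ⟨⟨w', p'⟩, hp'⟩ h
    have h' : p.support.tail = p'.support.tail := congrArg Subtype.val h
    have hw : w = w' := by rw [← endpt_support_tail p, h', endpt_support_tail]
    subst hw
    have : p = p' := SimpleGraph.Walk.ext_support (by
      rw [← p.cons_tail_support, h', p'.cons_tail_support])
    subst this
    rfl
  · rintro ⟨l, hl⟩
    obtain ⟨⟨h1, h2⟩, h3⟩ := (hmem l).1 hl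
    obtain ⟨w, p, hp⟩ := exists_walk_of_isWalkFrom h1
    refine ⟨⟨⟨w, p⟩, ?_, ?_⟩, Subtype.ext ?_⟩
    · rw [SimpleGraph.Walk.isPath_def]
      exact hp ▸ h3
    · have := p.length_support
      rw [hp, List.length_cons, h2] at this
      exact Nat.succ_injective this.symm
    · change p.support.tail = l
      rw [hp, List.tail_cons]

/-- Otherwise every vertex would be joined to `v` by a path of fewer than `n` steps, and local
finiteness allows only finitely many such vertices. This gives `1 ≤ μ`. -/
theorem one_le_cnt_saw [Infinite V] [G.LocallyFinite] (hconn : G.Connected) (v : V) (n : ℕ) :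
    1 ≤ cnt G (fun v l => (v :: l).Nodup) v n := by
  by_contra hcon
  have h0 := (cnt_eq_zero_iff G).1 (show cnt G (fun v l => (v :: l).Nodup) v n = 0 by omega)
  refine Set.infinite_univ (α := V) (((Finset.range n).biUnion fun k =>
    (walks G v k).image (endpt v)).finite_toSet.subset fun w _ => ?_)
  obtain ⟨p, hp⟩ := hconn.exists_isPath v w
  set l := p.support.tail with hl
  have hwalk : IsWalkFrom G v l := isWalkFrom_support_tail p
  have hnd : (v :: l).Nodup := by
    rw [hl, p.cons_tail_support]
    exact hp.support_nodup
  have hlen : l.length < n := by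
    by_contra hlen
    have hwalk' := hwalk
    rw [← List.take_append_drop n l, isWalkFrom_append] at hwalk'
    refine h0 (l.take n) ((mem_walks G).2 ⟨hwalk'.1, ?_⟩) ?_
    · rw [List.length_take]
      omega
    · exact hnd.sublist ((List.take_sublist n l).cons_cons v)
  simp only [Finset.mem_coe, Finset.mem_biUnion, Finset.mem_image, Finset.mem_range]
  exact ⟨_, hlen, l, (mem_walks G).2 ⟨hwalk, rfl⟩, endpt_support_tail p⟩

theorem cnt_saw_add_le [G.LocallyFinite] {Γ : Subgroup (G ≃g G)}
    (hΓ : ∀ v w : V, ∃ γ ∈ Γ, γ v = w) (v : V) (m n : ℕ) :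
    cnt G (fun v l => (v :: l).Nodup) v (m + n)
      ≤ cnt G (fun v l => (v :: l).Nodup) v m * cnt G (fun v l => (v :: l).Nodup) v n := by
  refine cnt_add_le G (R := fun v l => (v :: l).Nodup) ?_ fun w => ?_
  · intro l l' _ _ h
    rw [← List.cons_append] at h
    refine ⟨h.of_append_left, ?_⟩
    rw [List.nodup_cons]
    rw [List.nodup_append] at h
    exact ⟨fun hmem => h.2.2 _ (endpt_mem v l) _ hmem rfl, h.2.1⟩
  · refine (cnt_eq_of_transitive hΓ _ (fun γ _ u l => ?_) w v n).le
    rw [← List.map_cons, List.nodup_map_iff γ.injective]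

/-- The generating function of the walks that are self-avoiding apart from their starting vertex
has bounded partial sums inside the disc of convergence. -/
theorem exists_bound_generating_function [G.LocallyFinite] {Γ : Subgroup (G ≃g G)}
    (hΓ : ∀ v w : V, ∃ γ ∈ Γ, γ v = w) {v : V} {μ : ℝ} (hμ : 0 < μ)
    (hlim : Tendsto (fun n : ℕ =>
      (cnt G (fun v l => (v :: l).Nodup) v n : ℝ) ^ ((1 : ℝ) / (n : ℝ))) atTop (nhds μ))
    {z : ℝ} (hz : 0 < z) (hzμ : z * μ < 1) :
    ∃ C : ℝ, ∀ n, ∑ N ∈ Finset.range n, (cnt G (fun _ l => l.Nodup) v N : ℝ) * z ^ N ≤ C := by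
  obtain ⟨ρ, hρ1, hρ2⟩ := exists_between (show μ < 1 / z by rwa [lt_div_iff₀ hz, mul_comm])
  have hρz : ρ * z < 1 := by rwa [lt_div_iff₀ hz] at hρ2
  have hρ0 : 0 < ρ := hμ.trans hρ1
  set d := cnt G (fun _ _ => True) v 1
  -- Without its first step such a walk is properly self-avoiding, so allowing a return to the start
  -- costs only the factor `d`.
  have hstep : ∀ N, cnt G (fun _ l => l.Nodup) v (1 + N)
      ≤ d * cnt G (fun v l => (v :: l).Nodup) v N := by
    intro N
    refine cnt_add_le G (R := fun v l => (v :: l).Nodup) ?_ fun w => ?_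
    · intro l l' hl _ h
      obtain ⟨a, rfl⟩ := List.length_eq_one_iff.1 hl
      exact ⟨trivial, h⟩
    · refine (cnt_eq_of_transitive hΓ _ (fun γ _ u l => ?_) w v N).le
      rw [← List.map_cons, List.nodup_map_iff γ.injective]
  have hsummable : Summable fun N => (cnt G (fun _ l => l.Nodup) v N : ℝ) * z ^ N := by
    rw [← summable_nat_add_iff 1]
    refine Summable.of_norm_bounded_eventually_nat (g := fun N => d * z * (ρ * z) ^ N)
      ((summable_geometric_of_lt_one (by positivity) hρz).mul_left _) ?_
    filter_upwards [eventually_le_pow hlim hρ1] with N hN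
    rw [Real.norm_of_nonneg (by positivity)]
    have h1 : (cnt G (fun _ l => l.Nodup) v (N + 1) : ℝ)
        ≤ d * cnt G (fun v l => (v :: l).Nodup) v N := by
      rw [add_comm N 1]
      exact_mod_cast hstep N
    calc (cnt G (fun _ l => l.Nodup) v (N + 1) : ℝ) * z ^ (N + 1)
        ≤ d * ρ ^ N * z ^ (N + 1) := by
          gcongr
          exact h1.trans (by gcongr)
      _ = d * z * (ρ * z) ^ N := by ring
  exact ⟨_, fun n => hsummable.sum_le_tsum _ fun N _ => by positivity⟩

end SawCount

/-! ### Lifting walks from the directed quotient -/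

section DirSawCount

open scoped Classical

variable {V : Type*} {G : SimpleGraph V}

theorem exists_bijOn_Iio {s : Set V} (hs : s.Finite) (u : V) :
    ∃ f : ℕ → V, Set.BijOn f (Set.Iio s.ncard) s := by
  have := hs.to_subtype
  let e : s ≃ Fin s.ncard := Finite.equivFin s
  refine ⟨fun i => if h : i < s.ncard then (e.symm ⟨i, h⟩ : V) else u, ?_, ?_, ?_⟩
  · intro i hi
    rw [Set.mem_Iio] at hi
    dsimp only
    rw [dif_pos hi]
    exact Subtype.coe_prop _
  · intro i hi j hj h
    rw [Set.mem_Iio] at hi hj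
    dsimp only at h
    rw [dif_pos hi, dif_pos hj] at h
    exact congrArg Fin.val (e.symm.injective (Subtype.ext h))
  · intro x hx
    refine ⟨e ⟨x, hx⟩, (e ⟨x, hx⟩).2, ?_⟩
    dsimp only
    rw [dif_pos (e ⟨x, hx⟩).2]
    simp

theorem exists_enumeration [G.LocallyFinite] (u : V) (S : Set V) :
    ∃ f : ℕ → V, Set.BijOn f (Set.Iio (nbrCount G u S)) (G.neighborSet u ∩ S) :=
  exists_bijOn_Iio ((Set.toFinite (G.neighborSet u)).inter_of_left S) u

/-- An enumeration of the neighbours of `u` in `S`. -/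
noncomputable def nbr (G : SimpleGraph V) [G.LocallyFinite] (u : V) (S : Set V) : ℕ → V :=
  (exists_enumeration (G := G) u S).choose

theorem nbr_bijOn [G.LocallyFinite] (u : V) (S : Set V) :
    Set.BijOn (nbr G u S) (Set.Iio (nbrCount G u S)) (G.neighborSet u ∩ S) :=
  (exists_enumeration (G := G) u S).choose_spec

variable (A : Subgroup (G ≃g G))

/-- The orbit of a vertex, as a vertex of the directed quotient graph. -/
def toQuotient (v : V) : DirQuotient A := orb A v

/-- The vertices of an orbit. -/
def fibre (y : DirQuotient A) : Set V := {w | toQuotient A w = y}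

theorem edgeMult_toQuotient (u : V) (z : DirQuotient A) :
    edgeMult A (toQuotient A u) z = nbrCount G u (fibre A z) := by
  have h : MulAction.orbitRel.Quotient.orbit (z : MulAction.orbitRel.Quotient A V)
      = fibre A z := by
    ext w
    exact MulAction.orbitRel.Quotient.mem_orbit
  rw [← h]
  rfl

variable [G.LocallyFinite]

/-- The lift to `G`, starting at `v`, of a walk on the directed quotient graph. -/
noncomputable def lift (v : V) {x : DirQuotient A} :
    ∀ {y : DirQuotient A}, Quiver.Path x y → List V
  | _, .nil => []
  | z, .cons p e => lift v p ++ [nbr G (endpt v (lift v p)) (fibre A z) (Fin.val e)]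

variable {A}

theorem endpt_lift {v : V} {y : DirQuotient A} (p : Quiver.Path (toQuotient A v) y) :
    toQuotient A (endpt v (lift A v p)) = y ∧ IsWalkFrom G v (lift A v p) := by
  induction p with
  | nil => exact ⟨rfl, trivial⟩
  | @cons y z p e ih =>
    have hlt : Fin.val e < nbrCount G (endpt v (lift A v p)) (fibre A z) := by
      rw [← edgeMult_toQuotient, ih.1]
      exact Fin.isLt e
    have hm := (nbr_bijOn (G := G) (endpt v (lift A v p)) (fibre A z)).mapsTo hlt
    rw [lift, endpt_append, isWalkFrom_append]
    exact ⟨hm.2, ih.2, hm.1, trivial⟩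

theorem vertices_lift {v : V} {y : DirQuotient A} (p : Quiver.Path (toQuotient A v) y) :
    p.vertices = (v :: lift A v p).map (toQuotient A) := by
  induction p with
  | nil => rfl
  | @cons y z p e ih =>
    have h := (endpt_lift (p.cons e)).1
    rw [lift, endpt_append] at h
    rw [Quiver.Path.vertices_cons, ih, lift, ← List.cons_append, List.map_append,
      List.concat_eq_append]
    congr 1
    simpa using h.symm

theorem length_lift {v : V} {y : DirQuotient A} (p : Quiver.Path (toQuotient A v) y) :
    (lift A v p).length = p.length := by
  have := p.vertices_length
  rw [vertices_lift] at this
  simpa using this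

/-- Parallel edges are numbered by the neighbours of the current lifted vertex in the target orbit,
so the next vertex of the lift determines both the target and the edge used. -/
theorem lift_injective {v : V} {y y' : DirQuotient A} (p : Quiver.Path (toQuotient A v) y)
    (p' : Quiver.Path (toQuotient A v) y') (h : lift A v p = lift A v p') :
    (⟨y, p⟩ : Σ y, Quiver.Path (toQuotient A v) y) = ⟨y', p'⟩ := by
  induction p generalizing y' with
  | nil =>
    cases p' with
    | nil => rfl
    | cons p' e' => simp [lift] at h
  | @cons y z p e ih =>
    cases p' with
    | nil => simp [lift] at h
    | @cons w _ p' e' =>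
      have hz : y' = z := by
        rw [← (endpt_lift (p.cons e)).1, h, (endpt_lift (p'.cons e')).1]
      subst hz
      rw [lift, lift] at h
      obtain ⟨h1, h2⟩ := List.append_inj' h rfl
      have h3 := ih p' h1
      obtain ⟨rfl, h3⟩ := Sigma.mk.inj_iff.1 h3
      obtain rfl := eq_of_heq h3
      have hlt : ∀ e : y ⟶ y',
          Fin.val e ∈ Set.Iio (nbrCount G (endpt v (lift A v p)) (fibre A y')) := by
        intro e
        change Fin.val e < _
        rw [← edgeMult_toQuotient, (endpt_lift p).1]
        exact Fin.isLt e
      have h4 := (nbr_bijOn (G := G) (endpt v (lift A v p)) (fibre A y')).injOn (hlt e) (hlt e')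
        (List.singleton_injective h2)
      have h5 : e = e' := Fin.ext h4
      rw [h5]

theorem exists_lift_eq {v : V} (l : List V) (hl : IsWalkFrom G v l) :
    ∃ (y : DirQuotient A) (p : Quiver.Path (toQuotient A v) y), lift A v p = l := by
  induction l using List.reverseRecOn with
  | nil => exact ⟨_, Quiver.Path.nil, rfl⟩
  | append_singleton l a ih =>
    rw [isWalkFrom_append] at hl
    obtain ⟨y, p, rfl⟩ := ih hl.1
    obtain ⟨i, hi, hia⟩ := (nbr_bijOn (G := G) (endpt v (lift A v p))
      (fibre A (toQuotient A a))).surjOn ⟨hl.2.1, rfl⟩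
    have hi' : i < edgeMult A y (toQuotient A a) := by
      rw [← (endpt_lift p).1, edgeMult_toQuotient]
      exact hi
    let e : y ⟶ toQuotient A a := (⟨i, hi'⟩ : Fin (edgeMult A y (toQuotient A a)))
    refine ⟨_, p.cons e, ?_⟩
    rw [lift]
    congr 2

/-- Lifting is a bijection onto the walks from `v`, and the vertices of a quotient walk are the
orbits of its lift, so self-avoidance downstairs is transversality upstairs. -/
theorem dirSawCount_eq_cnt (v : V) (n : ℕ) :
    dirSawCount (DirQuotient A) (toQuotient A v) n
      = cnt G (fun v l => Transversal A (v :: l)) v n := by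
  have hmem : ∀ l, l ∈ (walks G v n).filter (fun l => Transversal A (v :: l)) ↔
      (IsWalkFrom G v l ∧ l.length = n) ∧ Transversal A (v :: l) := fun l => by
    rw [Finset.mem_filter, mem_walks]
  have hcnt : cnt G (fun v l => Transversal A (v :: l)) v n
      = Nat.card {l // l ∈ (walks G v n).filter (fun l => Transversal A (v :: l))} := by
    rw [Nat.card_eq_fintype_card, Fintype.card_coe, cnt]
  rw [hcnt, dirSawCount]
  refine Nat.card_congr (Equiv.ofBijective
    (fun p => ⟨lift A v p.1.2, (hmem _).2 ⟨⟨(endpt_lift _).2, ?_⟩, ?_⟩⟩) ⟨?_, ?_⟩)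
  · rw [length_lift, p.2.2]
  · have := p.2.1
    rw [vertices_lift] at this
    exact this
  · rintro ⟨⟨y, p⟩, hp⟩ ⟨⟨y', p'⟩, hp'⟩ h
    exact Subtype.ext (lift_injective p p' (congrArg Subtype.val h))
  · rintro ⟨l, hl⟩
    obtain ⟨⟨h1, h2⟩, h3⟩ := (hmem l).1 hl
    obtain ⟨y, p, rfl⟩ := exists_lift_eq (A := A) l h1
    refine ⟨⟨⟨y, p⟩, ?_, ?_⟩, rfl⟩
    · rw [vertices_lift]
      exact h3
    · rw [← length_lift, h2]

theorem cnt_transversal_add_le {Γ : Subgroup (G ≃g G)} (hN : Normalizes Γ A)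
    (hΓ : ∀ v w : V, ∃ γ ∈ Γ, γ v = w) (v : V) (m n : ℕ) :
    cnt G (fun v l => Transversal A (v :: l)) v (m + n)
      ≤ cnt G (fun v l => Transversal A (v :: l)) v m
        * cnt G (fun v l => Transversal A (v :: l)) v n := by
  refine cnt_add_le G (R := fun v l => Transversal A (v :: l)) ?_ fun w => ?_
  · intro l l' _ _ h
    rw [← List.cons_append] at h
    refine ⟨h.append.1, ?_⟩
    unfold Transversal at h ⊢
    rw [List.map_append, List.nodup_append] at h
    rw [List.map_cons, List.nodup_cons]
    exact ⟨fun hmem => h.2.2 _ (List.mem_map_of_mem (endpt_mem v l)) _ hmem rfl, h.2.1⟩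
  · refine (cnt_eq_of_transitive hΓ _ (fun γ hγ u l => ?_) w v n).le
    rw [← List.map_cons, hN.transversal_map hγ]

end DirSawCount

end SAW

/-! ### The main theorem -/

theorem theorem3p2 {V : Type*} [Infinite V] (G : SimpleGraph V)
    (hconn : G.Connected) (hfin : ∀ v : V, (G.neighborSet v).Finite)
    (Γ A : Subgroup (G ≃g G)) (hΓ : ∀ v w : V, ∃ γ ∈ Γ, γ v = w)
    (hAΓ : A ≤ Γ) (hnormal : (A.subgroupOf Γ).Normal) (hA : A ≠ ⊥)
    (hL : SAW.orbitLength A ≠ 2 ∨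
      (SAW.orbitLength A = 2 ∧ (SAW.CondI A ∨ SAW.CondII A))) :
    ∃ μ' μ : ℝ, SAW.IsDirConnectiveConstant (SAW.DirQuotient A) μ' ∧
      SAW.IsConnectiveConstant G μ ∧ μ' < μ := by
  have : G.LocallyFinite := fun v => (hfin v).fintype
  obtain ⟨v⟩ := hconn.nonempty
  have hN : SAW.Normalizes Γ A := fun γ hγ a ha =>
    hnormal.conj_mem ⟨a, hAΓ ha⟩ ha ⟨γ, hγ⟩
  obtain ⟨S, r, hS⟩ : ∃ S r, SAW.Pattern A S r := by
    rcases hL with hL | ⟨hL, h | h⟩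
    · exact (SAW.condII_of_orbitLength_ne_two hconn hA hL).exists_pattern
    · exact h.exists_pattern hL
    · exact h.exists_pattern
  obtain ⟨μ', hμ'0, hμ'lim, hμ'le⟩ :=
    SAW.exists_growth_rate _ (SAW.cnt_transversal_add_le hN hΓ v)
  obtain ⟨μ, hμ0, hμlim, hμle⟩ := SAW.exists_growth_rate _ (SAW.cnt_saw_add_le hΓ v)
  have hμ1 : 1 ≤ μ := by
    refine ge_of_tendsto' hμlim fun n => Real.one_le_rpow ?_ (by positivity)
    exact_mod_cast SAW.one_le_cnt_saw hconn v n
  refine ⟨μ', μ, fun x => ?_, fun w => ?_, ?_⟩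
  · obtain ⟨w, rfl⟩ : ∃ w, SAW.toQuotient A w = x := Quotient.exists_rep x
    simp only [SAW.dirSawCount_eq_cnt]
    refine hμ'lim.congr fun n => ?_
    rw [SAW.cnt_eq_of_transitive hΓ _ (fun γ hγ u l => ?_) v w n]
    rw [← List.map_cons, hN.transversal_map hγ]
  · simp only [SAW.sawCount_eq_cnt]
    refine hμlim.congr fun n => ?_
    rw [SAW.cnt_eq_of_transitive hΓ _ (fun γ _ u l => ?_) v w n]
    rw [← List.map_cons, List.nodup_map_iff γ.injective]
  · obtain ⟨n, hn1, hn⟩ := SAW.exists_transversal_lt hconn hAΓ hN hΓ hS (v := v) hμ1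
      fun z hz hzμ => SAW.exists_bound_generating_function hΓ (by linarith) hμlim hz hzμ
    -- By Fekete's lemma `μ' ^ n` is at most the number of transversal walks for every `n ≥ 1`, so a
    -- strict inequality at one length is enough.
    exact lt_of_pow_lt_pow_left₀ n hμ0 ((hμ'le n hn1).trans_lt hn)
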